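/- Let $X$ be a closed and bounded subset of a Euclidean space, with its Borel $\sigma$-algebra, and let $\mathcal P(X)$ be the set of Borel probability measures on $X$. An adversarial divergence over $X$ is a function of the form $\tau(\mu\|\nu)=\sup_{g\in\mathcal F}\mathbb E_{\mu\otimes\nu}[g]$ on $\mathcal P(X)\times\mathcal P(X)$, where $\mathcal F\neq\emptyset$ is a set of bounded continuous functions on $X\times X$; it is strict if for every $\mu^*\in\mathcal P(X)$ the function $\tau(\mu^*\|\cdot)$ is minimized exactly at $\mu^*$. Say that $\tau_1$ is stronger than $\tau_2$ (and $\tau_2$ weaker than $\tau_1$) if, for every $\mu^*\in\mathcal P(X)$ and every sequence $(\mu_n)$ in $\mathcal P(X)$, $\tau_1(\mu^*\|\mu_n)\to\inf_\mu\tau_1(\mu^*\|\mu)$ implies $\tau_2(\mu^*\|\mu_n)\to\inf_\mu\tau_2(\mu^*\|\mu)$; equivalent ($\equiv$) if each is stronger than the other; $\tau_1$ is strictly stronger than $\tau_2$ if it is stronger and not equivalent; they are not comparable if neither is stronger than the other. Let $\tau_{\mathrm{Trivial}}(\mu\|\nu)$ be $0$ if $\mu=\nu$ and $+\infty$ otherwise.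 For $f:\mathbb R\to\mathbb R\cup\{+\infty\}$ with convex conjugate $f^*(t)=\sup_{x}(tx-f(x))$ let $$\tau_f(\mu\|\nu)=\sup_{v}\ \mathbb E_{x\sim\mu,\,y\sim\nu}\left[v(x)-f^*(v(y))\right],$$ the supremum being over bounded continuous $v:X\to\mathbb R$ with values in $\{f^*<+\infty\}$. Let $\tau_{\mathrm{KL}},\tau_{\mathrm{Reverse\text{-}KL}},\tau_{\mathrm{TV}},\tau_{\mathrm{JS}},\tau_{\mathrm{Hellinger}}$ be $\tau_f$ for $f(x)=x\log x$, $-\log x$, $\tfrac12|x-1|$, $-(x+1)\log\frac{x+1}2+x\log x$, $(\sqrt x-1)^2$, respectively, where $f=+\infty$ outside the natural domain, which is $(0,\infty)$ for $-\log x$, $\mathbb R$ for $\tfrac12|x-1|$, and $[0,\infty)$ for the other three (with $0\log 0=0$). Let $k:X\times X\to\mathbb R$ be a universal kernel (continuous, symmetric, positive semidefinite, with the span of the functions $k(x,\cdot)$ dense in $C(X)$ in the uniform norm), and let $\tau_{\mathrm{MMD}}(\mu\|\nu)=\sup_v(\mathbb E_\mu[v]-\mathbb E_\nu[v])$ over all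 $v=\mathbb E_{y\sim s}[k(\cdot,y)]$ with $s$ a finite signed Borel measure on $X$ such that $\mathbb E_{s\otimes s}[k]\le 1$. Let $K>0$ and let $\tau_{\mathrm{Wasserstein}}(\mu\|\nu)=\sup_v(\mathbb E_\mu[v]-\mathbb E_\nu[v])$ over all bounded $K$-Lipschitz $v:X\to\mathbb R$. Then: 1. All eight of these are strict adversarial divergences. 2. $\tau_{\mathrm{Trivial}}$ is stronger than every strict adversarial divergence, and every strict adversarial divergence is stronger than $\tau_{\mathrm{Wasserstein}}$ and than $\tau_{\mathrm{MMD}}$. 3. $\tau_{\mathrm{TV}}\equiv\tau_{\mathrm{JS}}\equiv\tau_{\mathrm{Hellinger}}$ and $\tau_{\mathrm{Wasserstein}}\equiv\tau_{\mathrm{MMD}}$. 4. $\tau_{\mathrm{KL}}$ and $\tau_{\mathrm{Reverse\text{-}KL}}$ are each stronger than $\tau_{\mathrm{TV}}$. 5. If $X$ is infinite, then $\tau_{\mathrm{Trivial}}$ is strictly stronger than $\tau_{\mathrm{KL}}$ and than $\tau_{\mathrm{Reverse\text{-}KL}}$; $\tau_{\mathrm{KL}}$ and $\tau_{\mathrm{Reverse\text{-}KL}}$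 are each strictly stronger than $\tau_{\mathrm{TV}}$ and are not comparable with each other; and $\tau_{\mathrm{TV}}$ is strictly stronger than $\tau_{\mathrm{Wasserstein}}$. -/

import Mathlib

open MeasureTheory Filter Topology
open scoped NNReal BoundedContinuousFunction

noncomputable section

namespace AdvDiv

/-- The type of functions `(μ, ν) ↦ τ(μ ‖ ν)` on pairs of probability measures on `X`. -/
abbrev Divergence (X : Type*) [MeasurableSpace X] : Type _ :=
  ProbabilityMeasure X → ProbabilityMeasure X → EReal

/-- `(μ, ν) ↦ sup_{g ∈ F} E_{μ ⊗ ν}[g]` for a class `F` of functions on `X × X`. -/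
def supDiv {X : Type*} [MeasurableSpace X] (F : Set (X × X → ℝ)) : Divergence X :=
  fun μ ν => ⨆ g ∈ F, ((∫ z, g z ∂((μ : Measure X).prod (ν : Measure X)) : ℝ) : EReal)

/-- Adversarial divergences: suprema over a nonempty class of bounded continuous functions on
`X × X`. -/
def IsAdversarial {X : Type*} [TopologicalSpace X] [MeasurableSpace X] (τ : Divergence X) : Prop :=
  ∃ F : Set (X × X → ℝ), F.Nonempty ∧
    (∀ g ∈ F, Continuous g ∧ ∃ C : ℝ, ∀ z, |g z| ≤ C) ∧ τ = supDiv F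

/-- The global minimum `inf_ν τ(μ ‖ ν)`. -/
def minVal {X : Type*} [MeasurableSpace X] (τ : Divergence X) (μ : ProbabilityMeasure X) : EReal :=
  ⨅ ν : ProbabilityMeasure X, τ μ ν

/-- The set of minimizers of `τ(μ ‖ ·)`. -/
def opt {X : Type*} [MeasurableSpace X] (τ : Divergence X) (μ : ProbabilityMeasure X) :
    Set (ProbabilityMeasure X) :=
  {ν | τ μ ν = minVal τ μ}

/-- Strict adversarial divergences. -/
def IsStrict {X : Type*} [TopologicalSpace X] [MeasurableSpace X] (τ : Divergence X) : Prop :=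
  IsAdversarial τ ∧ ∀ μ : ProbabilityMeasure X, opt τ μ = {μ}

/-! Relative strength. -/

/-- `τ₁` is stronger than `τ₂`. -/
def Stronger {X : Type*} [MeasurableSpace X] (τ₁ τ₂ : Divergence X) : Prop :=
  ∀ (ν : ℕ → ProbabilityMeasure X) (μ : ProbabilityMeasure X),
    Tendsto (fun n => τ₁ μ (ν n)) atTop (𝓝 (minVal τ₁ μ)) →
      Tendsto (fun n => τ₂ μ (ν n)) atTop (𝓝 (minVal τ₂ μ))

def Equivalent {X : Type*} [MeasurableSpace X] (τ₁ τ₂ : Divergence X) : Prop :=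
  Stronger τ₁ τ₂ ∧ Stronger τ₂ τ₁

def StrictlyStronger {X : Type*} [MeasurableSpace X] (τ₁ τ₂ : Divergence X) : Prop :=
  Stronger τ₁ τ₂ ∧ ¬ Equivalent τ₁ τ₂

def NotComparable {X : Type*} [MeasurableSpace X] (τ₁ τ₂ : Divergence X) : Prop :=
  ¬ Stronger τ₁ τ₂ ∧ ¬ Stronger τ₂ τ₁

open Classical in
/-- The trivial divergence. -/
def trivialDiv (X : Type*) [MeasurableSpace X] : Divergence X :=
  fun μ ν => if μ = ν then 0 else ⊤

/-! The `f`-GAN objective. -/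

/-- The convex conjugate `f*(t) = sup_x (t x - f x)` of `f : ℝ → ℝ ∪ {+∞}`. -/
def conj (f : ℝ → EReal) (t : ℝ) : EReal := ⨆ x : ℝ, ((t * x : ℝ) : EReal) - f x

/-- The class of functions `(x, y) ↦ v x - f*(v y)`, for `v` bounded continuous with values in the
effective domain of `f*`. -/
def fGANClass (X : Type*) [TopologicalSpace X] (f : ℝ → EReal) : Set (X × X → ℝ) :=
  {g | ∃ v : X →ᵇ ℝ, (∀ x, conj f (v x) < ⊤) ∧ g = fun z => v z.1 - (conj f (v z.2)).toReal}

def fGAN (X : Type*) [TopologicalSpace X] [MeasurableSpace X] (f : ℝ → EReal) : Divergence X :=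
  supDiv (fGANClass X f)

/-- `x log x` on `[0, ∞)`, and `+∞` elsewhere. -/
def fKL (x : ℝ) : EReal := if 0 ≤ x then ((x * Real.log x : ℝ) : EReal) else ⊤

/-- `- log x` on `(0, ∞)`, and `+∞` elsewhere. -/
def fRKL (x : ℝ) : EReal := if 0 < x then ((-Real.log x : ℝ) : EReal) else ⊤

/-- `|x - 1| / 2` on `ℝ`. -/
def fTV (x : ℝ) : EReal := ((1 / 2 * |x - 1| : ℝ) : EReal)

/-- `- (x + 1) log ((x + 1) / 2) + x log x` on `[0, ∞)`, and `+∞` elsewhere. -/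
def fJS (x : ℝ) : EReal :=
  if 0 ≤ x then ((-(x + 1) * Real.log ((x + 1) / 2) + x * Real.log x : ℝ) : EReal) else ⊤

/-- `(√x - 1)²` on `[0, ∞)`, and `+∞` elsewhere. -/
def fHellinger (x : ℝ) : EReal := if 0 ≤ x then (((Real.sqrt x - 1) ^ 2 : ℝ) : EReal) else ⊤

def klDivergence (X : Type*) [TopologicalSpace X] [MeasurableSpace X] : Divergence X :=
  fGAN X fKL

def reverseKLDivergence (X : Type*) [TopologicalSpace X] [MeasurableSpace X] : Divergence X :=
  fGAN X fRKL

def tvDivergence (X : Type*) [TopologicalSpace X] [MeasurableSpace X] : Divergence X :=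
  fGAN X fTV

def jsDivergence (X : Type*) [TopologicalSpace X] [MeasurableSpace X] : Divergence X :=
  fGAN X fJS

def hellingerDivergence (X : Type*) [TopologicalSpace X] [MeasurableSpace X] : Divergence X :=
  fGAN X fHellinger

/-! The MMD-GAN objective. -/

/-- A universal reproducing kernel: a continuous, symmetric, positive semidefinite kernel whose
sections `k x` span a dense subspace of the continuous functions. (On a compact space the topology
of `C(X, ℝ)` is that of uniform convergence.) -/
structure IsUniversalKernel {X : Type*} [TopologicalSpace X] (k : X → X → ℝ) : Prop where
  continuous : Continuous (fun z : X × X => k z.1 z.2)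
  posSemidef : (Matrix.of k).PosSemidef
  dense : Dense (Submodule.span ℝ {φ : C(X, ℝ) | ∃ x, ∀ y, φ y = k x y} : Set C(X, ℝ))

/-- The integral of `φ` against a finite signed measure, through its Jordan decomposition. -/
def signedIntegral {X : Type*} [MeasurableSpace X] (s : SignedMeasure X) (φ : X → ℝ) : ℝ :=
  ∫ x, φ x ∂s.toJordanDecomposition.posPart - ∫ x, φ x ∂s.toJordanDecomposition.negPart

/-- The class of functions `(x, y) ↦ v x - v y`, for `v x = E_s[k x ·]` with `s` a signed measure
satisfying `E_{s ⊗ s}[k] ≤ 1`. -/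
def mmdClass {X : Type*} [MeasurableSpace X] (k : X → X → ℝ) : Set (X × X → ℝ) :=
  {g | ∃ s : SignedMeasure X, signedIntegral s (fun x => signedIntegral s (k x)) ≤ 1 ∧
    g = fun z => signedIntegral s (k z.1) - signedIntegral s (k z.2)}

def mmdDivergence {X : Type*} [MeasurableSpace X] (k : X → X → ℝ) : Divergence X :=
  supDiv (mmdClass k)

/-! The Wasserstein-GAN objective. -/

/-- The class of functions `(x, y) ↦ v x - v y`, for `v` bounded and `K`-Lipschitz. -/
def wassersteinClass (X : Type*) [MetricSpace X] (K : ℝ≥0) : Set (X × X → ℝ) :=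
  {g | ∃ v : X →ᵇ ℝ, LipschitzWith K v ∧ g = fun z => v z.1 - v z.2}

def wassersteinDivergence (X : Type*) [MetricSpace X] [MeasurableSpace X] (K : ℝ≥0) :
    Divergence X :=
  supDiv (wassersteinClass X K)

end AdvDiv

end

/-!
A divergence `τ` of the form `sup_g E_{μ ⊗ ν}[g]` is weakly lower semicontinuous in `ν`, and the
probability measures on a compact space form a weakly compact space (Prokhorov). Hence a minimizing
sequence for `τ(μ ‖ ·)` with `τ` strict converges weakly to `μ` (`IsStrict.tendsto`). The
Wasserstein and MMD objectives are weakly continuous: for Wasserstein because the Lipschitz functions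
normalized at a base point are totally bounded, for MMD because the kernel is the Gram matrix of a continuous
map to a Hilbert space, where the objective is bounded by the distance of the mean embeddings. So
every strict divergence is stronger than both, and since both are strict they are equivalent. The
trivial divergence is the strongest one because its convergent sequences are eventually constant.

For the `f`-GAN objectives the conjugates are computed explicitly (`HasConj`). In every case the
conjugate `φ` satisfies `t ≤ φ t`, so `τ_f(μ ‖ μ) = 0`, and it is quadratically close to the
diagonal near some point `t₀`. Testing with `t₀ + s v`, for `v` an admissible test function of the total
variation, gives `τ_f ≥ s τ_TV - C s²` for small `s`, a weak form of Pinsker's inequality. It yields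
both the strictness of `τ_f` and that `τ_f` is stronger than `τ_TV`. Conversely, for
Jensen–Shannon and Hellinger the test functions are bounded above and the conjugate has a finite
limit at `-∞`, so they can be truncated from below at a small cost; bounded test functions are
controlled by `τ_TV` because `φ t ≥ t`. No density formula for `τ_f` is needed.

On an infinite space, moving a vanishing part of a point mass to another point is a small change for
Kullback–Leibler and an infinite one for its reverse, while removing the atoms of a purely atomic
measure one at a time has the opposite effect. Thus the two are not comparable, and by transitivity
neither is equivalent to the trivial divergence or to the total variation. Point masses at the
points of a convergent sequence separate the total variation from Wasserstein.
-/

set_option linter.unusedSectionVars false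

noncomputable section

namespace AdvDiv

/-! ### Suprema of expectations and minima -/

section Basic

variable {X : Type*} [MeasurableSpace X]

theorem le_supDiv {F : Set (X × X → ℝ)} {g : X × X → ℝ} (hg : g ∈ F) (μ ν : ProbabilityMeasure X) :
    ((∫ z, g z ∂((μ : Measure X).prod (ν : Measure X)) : ℝ) : EReal) ≤ supDiv F μ ν :=
  le_iSup₂_of_le g hg le_rfl

theorem minVal_eq_zero {τ : Divergence X} (h0 : ∀ μ, τ μ μ = 0)
    (hpos : ∀ μ ν, μ ≠ ν → 0 < τ μ ν) (μ : ProbabilityMeasure X) : minVal τ μ = 0 := by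
  refine le_antisymm ((iInf_le _ μ).trans_eq (h0 μ)) (le_iInf fun ν => ?_)
  by_cases h : μ = ν
  · rw [← h, h0]
  · exact (hpos μ ν h).le

theorem isStrict_of_pos [TopologicalSpace X] {τ : Divergence X} (hA : IsAdversarial τ)
    (h0 : ∀ μ, τ μ μ = 0) (hpos : ∀ μ ν, μ ≠ ν → 0 < τ μ ν) : IsStrict τ := by
  refine ⟨hA, fun μ => Set.ext fun ν => ?_⟩
  simp only [opt, Set.mem_ofPred_eq, Set.mem_singleton_iff, minVal_eq_zero h0 hpos]
  refine ⟨fun h => ?_, fun h => h ▸ h0 _⟩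
  by_contra hne
  exact (hpos μ ν (Ne.symm hne)).ne' h

theorem Stronger.trans {τ₁ τ₂ τ₃ : Divergence X} (h₁ : Stronger τ₁ τ₂) (h₂ : Stronger τ₂ τ₃) :
    Stronger τ₁ τ₃ := fun ν μ h => h₂ ν μ (h₁ ν μ h)

theorem tendsto_zero_of_eventually_le {a : ℕ → EReal} (h0 : ∀ n, 0 ≤ a n)
    (h : ∀ ε : ℝ, 0 < ε → ∀ᶠ n in atTop, a n ≤ (ε : EReal)) : Tendsto a atTop (𝓝 0) := by
  refine tendsto_order.2 ⟨fun b hb => .of_forall fun n => hb.trans_le (h0 n), fun b hb => ?_⟩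
  obtain ⟨ε, hε, hεb⟩ := EReal.lt_iff_exists_real_btwn.1 hb
  filter_upwards [h ε (by exact_mod_cast hε)] with n hn using hn.trans_lt hεb

theorem eventually_lt_of_tendsto_zero {a : ℕ → EReal} (h : Tendsto a atTop (𝓝 0)) {ε : ℝ}
    (hε : 0 < ε) : ∀ᶠ n in atTop, a n < (ε : EReal) :=
  h.eventually_lt_const (by exact_mod_cast hε)

theorem trivialDiv_self (μ : ProbabilityMeasure X) : trivialDiv X μ μ = 0 := if_pos rfl

theorem trivialDiv_of_ne {μ ν : ProbabilityMeasure X} (h : μ ≠ ν) : trivialDiv X μ ν = ⊤ :=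
  if_neg h

theorem trivialDiv_pos (μ ν : ProbabilityMeasure X) (h : μ ≠ ν) : 0 < trivialDiv X μ ν := by
  rw [trivialDiv_of_ne h]; exact EReal.zero_lt_top

theorem minVal_eq_self [TopologicalSpace X] {τ : Divergence X} (hτ : IsStrict τ)
    (μ : ProbabilityMeasure X) : τ μ μ = minVal τ μ := by
  have : μ ∈ opt τ μ := by rw [hτ.2 μ]; rfl
  exact this

theorem stronger_trivialDiv [TopologicalSpace X] {τ : Divergence X} (hτ : IsStrict τ) :
    Stronger (trivialDiv X) τ := by
  intro ν μ h
  rw [minVal_eq_zero trivialDiv_self trivialDiv_pos] at h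
  refine tendsto_const_nhds.congr' ?_ (f₁ := fun _ => minVal τ μ)
  filter_upwards [eventually_lt_of_tendsto_zero h one_pos] with n hn
  by_cases hne : μ = ν n
  · rw [← hne, minVal_eq_self hτ]
  · rw [trivialDiv_of_ne hne] at hn
    exact absurd hn not_top_lt

end Basic

/-! ### Adversarial divergences and weak convergence -/

section Weak

variable {X : Type*} [MetricSpace X] [CompactSpace X] [MeasurableSpace X] [BorelSpace X]

theorem integrable_of_continuous {Y E : Type*} [TopologicalSpace Y] [CompactSpace Y]
    [MeasurableSpace Y] [OpensMeasurableSpace Y] [SecondCountableTopology Y]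
    [TopologicalSpace.PseudoMetrizableSpace Y] [NormedAddCommGroup E]
    (μ : Measure Y) [IsFiniteMeasure μ] {f : Y → E} (hf : Continuous f) : Integrable f μ := by
  obtain ⟨C, hC⟩ := isCompact_univ.exists_bound_of_continuousOn hf.continuousOn
  exact ⟨hf.aestronglyMeasurable, HasFiniteIntegral.of_bounded (C := C)
    (.of_forall fun x => hC x trivial)⟩

theorem integral_prod_sub (μ ν : ProbabilityMeasure X) {v w : X → ℝ} (hv : Continuous v)
    (hw : Continuous w) :
    ∫ z, (v z.1 - w z.2) ∂((μ : Measure X).prod (ν : Measure X)) = ∫ x, v x ∂μ - ∫ x, w x ∂ν := by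
  rw [integral_sub (integrable_of_continuous _ (by fun_prop))
    (integrable_of_continuous _ (by fun_prop)), integral_fun_fst, integral_fun_snd]
  simp

theorem exists_integral_ne {μ ν : ProbabilityMeasure X} (h : μ ≠ ν) :
    ∃ v : X →ᵇ ℝ, ∫ x, v x ∂μ ≠ ∫ x, v x ∂ν := by
  by_contra! hall
  have : IsFiniteMeasure (μ : Measure X) := inferInstance
  have : IsFiniteMeasure (ν : Measure X) := inferInstance
  exact h (Subtype.ext (ext_of_forall_integral_eq_of_IsFiniteMeasure
    (μ := (μ : Measure X)) (ν := (ν : Measure X)) hall))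

theorem exists_integral_lt {μ ν : ProbabilityMeasure X} (h : μ ≠ ν) :
    ∃ v : X →ᵇ ℝ, ∫ x, v x ∂ν < ∫ x, v x ∂μ := by
  obtain ⟨v, hv⟩ := exists_integral_ne h
  rcases hv.lt_or_gt with h' | h'
  · exact ⟨-v, by simpa [integral_neg] using h'⟩
  · exact ⟨v, h'⟩

theorem continuous_integral {Y : Type*} [TopologicalSpace Y] [CompactSpace Y] [MeasurableSpace Y]
    [OpensMeasurableSpace Y] {g : Y → ℝ} (hg : Continuous g) :
    Continuous fun μ : ProbabilityMeasure Y => ∫ y, g y ∂(μ : Measure Y) :=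
  ProbabilityMeasure.continuous_integral_boundedContinuousFunction
    (BoundedContinuousFunction.mkOfCompact ⟨g, hg⟩)

theorem continuous_integral_prod {g : X × X → ℝ} (hg : Continuous g) :
    Continuous fun p : ProbabilityMeasure X × ProbabilityMeasure X =>
      ∫ z, g z ∂((p.1 : Measure X).prod (p.2 : Measure X)) :=
  (continuous_integral hg).comp ProbabilityMeasure.continuous_prod

theorem IsAdversarial.lowerSemicontinuous {τ : Divergence X} (hτ : IsAdversarial τ)
    (μ : ProbabilityMeasure X) : LowerSemicontinuous (τ μ) := by
  obtain ⟨F, -, hF, rfl⟩ := hτ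
  refine lowerSemicontinuous_biSup fun g hg => ?_
  have h1 : Continuous fun ν : ProbabilityMeasure X =>
      ((∫ z, g z ∂((μ : Measure X).prod (ν : Measure X)) : ℝ) : EReal) :=
    continuous_coe_real_ereal.comp
      ((continuous_integral_prod (hF g hg).1).comp (Continuous.prodMk_right μ))
  exact h1.lowerSemicontinuous

/-- Minimizing sequences of a strict adversarial divergence converge weakly: by lower
semicontinuity every cluster point is a minimizer, and the space of probability measures on a
compact space is compact. -/
theorem IsStrict.tendsto {τ : Divergence X} (hτ : IsStrict τ) {ν : ℕ → ProbabilityMeasure X}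
    {μ : ProbabilityMeasure X} (h : Tendsto (fun n => τ μ (ν n)) atTop (𝓝 (minVal τ μ))) :
    Tendsto ν atTop (𝓝 μ) := by
  refine le_nhds_of_unique_clusterPt fun ρ hρ => ?_
  have hle : τ μ ρ ≤ minVal τ μ := by
    refine le_of_forall_lt fun b hb => ?_
    obtain ⟨c, hbc, hc⟩ := exists_between hb
    have hfreq : ∃ᶠ n in atTop, c < τ μ (ν n) :=
      (mapClusterPt_iff_frequently.1 hρ) _ (hτ.1.lowerSemicontinuous μ ρ c hc)
    refine hbc.trans_le (le_of_not_gt fun hlt => hfreq ?_)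
    filter_upwards [h.eventually_lt_const hlt] with n hn using hn.not_gt
  have : ρ ∈ opt τ μ := le_antisymm hle (iInf_le _ ρ)
  rwa [hτ.2 μ] at this

/-- The class of functions `(x, y) ↦ v x - v y` with `v ∈ V`; `supDiv (diffClass V)` is the integral
probability metric of `V`. -/
def diffClass (V : Set (X → ℝ)) : Set (X × X → ℝ) :=
  {g | ∃ v ∈ V, g = fun z => v z.1 - v z.2}

theorem isAdversarial_of_continuous {Y : Type*} [TopologicalSpace Y] [CompactSpace Y]
    [MeasurableSpace Y] {F : Set (Y × Y → ℝ)} (hne : F.Nonempty)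
    (hF : ∀ g ∈ F, Continuous g) : IsAdversarial (supDiv F) := by
  refine ⟨F, hne, fun g hg => ⟨hF g hg, ?_⟩, rfl⟩
  obtain ⟨C, hC⟩ := isCompact_univ.exists_bound_of_continuousOn (hF g hg).continuousOn
  exact ⟨C, fun z => hC z trivial⟩

theorem diffClass_isAdversarial {V : Set (X → ℝ)} (hne : V.Nonempty)
    (hV : ∀ v ∈ V, Continuous v) : IsAdversarial (supDiv (diffClass V)) := by
  refine isAdversarial_of_continuous
    (hne.imp' (fun v z => v z.1 - v z.2) fun v hv => ⟨v, hv, rfl⟩) ?_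
  rintro _ ⟨v, hv, rfl⟩
  have := hV v hv
  fun_prop

theorem diffClass_le_supDiv {V : Set (X → ℝ)} {v : X → ℝ} (hv : v ∈ V) (hc : Continuous v)
    (μ ν : ProbabilityMeasure X) :
    ((∫ x, v x ∂μ - ∫ x, v x ∂ν : ℝ) : EReal) ≤ supDiv (diffClass V) μ ν := by
  rw [← integral_prod_sub μ ν hc hc]
  exact le_supDiv (F := diffClass V) ⟨v, hv, rfl⟩ μ ν

theorem supDiv_diffClass_le {V : Set (X → ℝ)} (hV : ∀ v ∈ V, Continuous v)
    {μ ν : ProbabilityMeasure X} {a : EReal}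
    (h : ∀ v ∈ V, ((∫ x, v x ∂μ - ∫ x, v x ∂ν : ℝ) : EReal) ≤ a) :
    supDiv (diffClass V) μ ν ≤ a := by
  refine iSup₂_le ?_
  rintro _ ⟨v, hv, rfl⟩
  rw [integral_prod_sub μ ν (hV v hv) (hV v hv)]
  exact h v hv

theorem supDiv_diffClass_self {V : Set (X → ℝ)} (hne : V.Nonempty) (hV : ∀ v ∈ V, Continuous v)
    (μ : ProbabilityMeasure X) : supDiv (diffClass V) μ μ = 0 := by
  refine le_antisymm (supDiv_diffClass_le hV fun v _ => by simp) ?_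
  obtain ⟨v, hv⟩ := hne
  simpa using diffClass_le_supDiv hv (hV v hv) μ μ

theorem supDiv_diffClass_pos {V : Set (X → ℝ)} (hV : ∀ v ∈ V, Continuous v)
    (hsep : ∀ μ ν : ProbabilityMeasure X, μ ≠ ν → ∃ v ∈ V, ∫ x, v x ∂ν < ∫ x, v x ∂μ)
    (μ ν : ProbabilityMeasure X) (h : μ ≠ ν) : 0 < supDiv (diffClass V) μ ν := by
  obtain ⟨v, hv, hlt⟩ := hsep μ ν h
  refine lt_of_lt_of_le ?_ (diffClass_le_supDiv hv (hV v hv) μ ν)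
  exact_mod_cast sub_pos.2 hlt

theorem isAdversarial_trivialDiv : IsAdversarial (trivialDiv X) := by
  have heq : trivialDiv X = supDiv (diffClass {v : X → ℝ | Continuous v}) := by
    funext μ ν
    by_cases h : μ = ν
    · rw [h, trivialDiv_self,
        supDiv_diffClass_self (V := {v : X → ℝ | Continuous v})
          ⟨fun _ => 0, continuous_const⟩ (fun v hv => hv)]
    · rw [trivialDiv_of_ne h, eq_comm, EReal.eq_top_iff_forall_lt]
      intro y
      obtain ⟨v, hv⟩ := exists_integral_lt h
      set d := ∫ x, v x ∂μ - ∫ x, v x ∂ν with hd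
      have hdpos : 0 < d := sub_pos.2 hv
      refine lt_of_lt_of_le ?_ (diffClass_le_supDiv (v := fun x => ((y + 1) / d) * v x)
        (by simp only [Set.mem_ofPred_eq]; fun_prop) (by fun_prop) μ ν)
      rw [integral_const_mul, integral_const_mul, ← mul_sub, ← hd, div_mul_cancel₀ _ hdpos.ne']
      exact_mod_cast lt_add_one y
  rw [heq]
  exact diffClass_isAdversarial ⟨fun _ => 0, continuous_const⟩ fun v hv => hv

theorem isStrict_trivialDiv : IsStrict (trivialDiv X) :=
  isStrict_of_pos isAdversarial_trivialDiv trivialDiv_self trivialDiv_pos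

end Weak

/-! ### The Wasserstein-GAN objective -/

section Wasserstein

variable {X : Type*} [MetricSpace X] [CompactSpace X] [MeasurableSpace X] [BorelSpace X]

theorem wassersteinDivergence_eq (K : ℝ≥0) :
    wassersteinDivergence X K = supDiv (diffClass {v : X → ℝ | LipschitzWith K v}) := by
  unfold wassersteinDivergence
  congr 1
  ext g
  constructor
  · rintro ⟨v, hv, rfl⟩
    exact ⟨v, hv, rfl⟩
  · rintro ⟨v, hv, rfl⟩
    exact ⟨.mkOfCompact ⟨v, hv.continuous⟩, hv, rfl⟩

/-- Lipschitz test functions determine weak convergence, hence separate probability measures. -/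
theorem exists_lipschitz_integral_lt {K : ℝ≥0} (hK : 0 < K) (μ ν : ProbabilityMeasure X)
    (h : μ ≠ ν) : ∃ v : X → ℝ, LipschitzWith K v ∧ ∫ x, v x ∂ν < ∫ x, v x ∂μ := by
  by_contra! hall
  refine h (tendsto_nhds_unique (f := fun _ : ℕ => μ) (l := atTop) tendsto_const_nhds ?_)
  refine tendsto_iff_forall_lipschitz_integral_tendsto.2 fun f _ ⟨L, hL⟩ => ?_
  -- rescaling by `c` turns an `L`-Lipschitz function into a `K`-Lipschitz one, even if `L = 0`
  set c : ℝ≥0 := K / (L + 1) with hc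
  have hcpos : 0 < c := by positivity
  have key : ∀ σ : ℝ, |σ| = 1 → LipschitzWith K fun x => σ * c * f x := by
    intro σ hσ
    refine LipschitzWith.of_dist_le_mul fun x y => ?_
    have h1 := hL.dist_le_mul x y
    rw [Real.dist_eq] at h1 ⊢
    rw [← mul_sub, abs_mul, abs_mul, hσ, one_mul, abs_of_nonneg c.coe_nonneg]
    have h2 : (c : ℝ) * L ≤ K := by
      have : c * L ≤ K := by
        rw [hc, div_mul_eq_mul_div, div_le_iff₀ (by positivity)]
        gcongr
        exact le_self_add
      exact_mod_cast this
    calc (c : ℝ) * |f x - f y| ≤ c * (L * dist x y) := by gcongr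
      _ = (c * L) * dist x y := by ring
      _ ≤ K * dist x y := by gcongr
  have h1 := hall _ (key 1 (by simp))
  have h2 := hall _ (key (-1) (by simp))
  simp only [integral_const_mul] at h1 h2
  have hc' : (0 : ℝ) < c := hcpos
  have heq : ∫ x, f x ∂μ = ∫ x, f x ∂ν := by
    have e1 : (c : ℝ) * ∫ x, f x ∂μ ≤ c * ∫ x, f x ∂ν := by linarith
    have e2 : (c : ℝ) * ∫ x, f x ∂ν ≤ c * ∫ x, f x ∂μ := by linarith
    exact le_antisymm (le_of_mul_le_mul_left e1 hc') (le_of_mul_le_mul_left e2 hc')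
  rw [heq]
  exact tendsto_const_nhds

theorem wassersteinDivergence_self (K : ℝ≥0) (μ : ProbabilityMeasure X) :
    wassersteinDivergence X K μ μ = 0 := by
  rw [wassersteinDivergence_eq]
  exact supDiv_diffClass_self (V := {v : X → ℝ | LipschitzWith K v})
    ⟨fun _ => 0, LipschitzWith.const' 0⟩ (fun _ hv => hv.continuous) μ

theorem wassersteinDivergence_pos {K : ℝ≥0} (hK : 0 < K) (μ ν : ProbabilityMeasure X)
    (h : μ ≠ ν) : 0 < wassersteinDivergence X K μ ν := by
  rw [wassersteinDivergence_eq]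
  exact supDiv_diffClass_pos (V := {v : X → ℝ | LipschitzWith K v})
    (fun _ hv => hv.continuous) (exists_lipschitz_integral_lt hK) μ ν h

theorem isStrict_wassersteinDivergence {K : ℝ≥0} (hK : 0 < K) :
    IsStrict (wassersteinDivergence X K) := by
  refine isStrict_of_pos ?_ (wassersteinDivergence_self K) (wassersteinDivergence_pos hK)
  rw [wassersteinDivergence_eq]
  exact diffClass_isAdversarial (V := {v : X → ℝ | LipschitzWith K v})
    ⟨fun _ => 0, LipschitzWith.const' 0⟩ (fun _ hv => hv.continuous)

/-- Arzelà–Ascoli: the `K`-Lipschitz functions vanishing at a base point form a totally bounded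
family. -/
theorem totallyBounded_lipschitz (K : ℝ≥0) (x₀ : X) :
    TotallyBounded {v : X →ᵇ ℝ | LipschitzWith K v ∧ v x₀ = 0} := by
  refine (BoundedContinuousFunction.arzela_ascoli
    (Set.Icc (-(K * Metric.diam (Set.univ : Set X))) (K * Metric.diam (Set.univ : Set X)))
    isCompact_Icc _ ?_ ?_).totallyBounded.subset subset_closure
  · rintro v x ⟨hv, h0⟩
    have h1 := hv.dist_le_mul x x₀
    rw [Real.dist_eq, h0, sub_zero] at h1
    refine abs_le.1 (h1.trans ?_)
    gcongr
    exact Metric.dist_le_diam_of_mem isCompact_univ.isBounded trivial trivial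
  · exact (LipschitzWith.uniformEquicontinuous _ K fun v => v.2.1).equicontinuous

/-- The Wasserstein objective is continuous for weak convergence: a finite net of the Lipschitz
functions normalized at a base point controls the supremum. -/
theorem tendsto_wassersteinDivergence (K : ℝ≥0) {ν : ℕ → ProbabilityMeasure X}
    {μ : ProbabilityMeasure X} (h : Tendsto ν atTop (𝓝 μ)) :
    Tendsto (fun n => wassersteinDivergence X K μ (ν n)) atTop (𝓝 0) := by
  have hne : Nonempty X := ProbabilityMeasure.nonempty μ
  obtain ⟨x₀⟩ := hne
  rw [wassersteinDivergence_eq]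
  have hcont : ∀ v ∈ {v : X → ℝ | LipschitzWith K v}, Continuous v := fun _ hv => hv.continuous
  refine tendsto_zero_of_eventually_le (fun n => ?_) fun ε hε => ?_
  · simpa using diffClass_le_supDiv (V := {v : X → ℝ | LipschitzWith K v}) (v := fun _ => 0)
      (LipschitzWith.const' 0) continuous_const μ (ν n)
  obtain ⟨t, htf, ht⟩ := Metric.totallyBounded_iff.1 (totallyBounded_lipschitz K x₀) (ε / 3)
    (by positivity)
  have hev : ∀ᶠ n in atTop, ∀ w ∈ t, |∫ x, w x ∂μ - ∫ x, w x ∂(ν n)| < ε / 3 := by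
    rw [htf.eventually_all]
    intro w _
    have h1 : Tendsto (fun n => ∫ x, w x ∂μ - ∫ x, w x ∂(ν n)) atTop (𝓝 0) := by
      simpa using (tendsto_const_nhds (x := ∫ x, w x ∂μ)).sub
        (((continuous_integral w.continuous).tendsto μ).comp h)
    have := h1.abs
    rw [abs_zero] at this
    exact this.eventually_lt_const (by positivity)
  filter_upwards [hev] with n hn
  refine supDiv_diffClass_le hcont fun v hv => ?_
  have hvc : Continuous v := hcont v hv
  let v' : X →ᵇ ℝ := .mkOfCompact ⟨fun x => v x - v x₀, by fun_prop⟩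
  have hv'L : LipschitzWith K v' := LipschitzWith.of_dist_le_mul fun x y => by
    have := LipschitzWith.dist_le_mul hv x y
    simpa [v', Real.dist_eq] using this
  have hv' : v' ∈ {v : X →ᵇ ℝ | LipschitzWith K v ∧ v x₀ = 0} := ⟨hv'L, by simp [v']⟩
  obtain ⟨w, hwt, hw⟩ := Set.mem_iUnion₂.1 (ht hv')
  rw [Metric.mem_ball] at hw
  have hclose : ∀ ρ : ProbabilityMeasure X, |∫ x, v x ∂ρ - v x₀ - ∫ x, w x ∂ρ| ≤ ε / 3 := by
    intro ρ
    have e1 : ∫ x, v x ∂ρ - v x₀ - ∫ x, w x ∂ρ = ∫ x, (v' x - w x) ∂(ρ : Measure X) := by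
      rw [integral_sub (integrable_of_continuous _ v'.continuous)
        (integrable_of_continuous _ w.continuous)]
      congr 1
      simp only [v', BoundedContinuousFunction.mkOfCompact_apply, ContinuousMap.coe_mk]
      rw [integral_sub (integrable_of_continuous _ hvc) (integrable_const _)]
      simp
    rw [e1, ← Real.norm_eq_abs]
    refine (norm_integral_le_of_norm_le_const (C := ε / 3) (.of_forall fun x => ?_)).trans (by simp)
    rw [← dist_eq_norm]
    exact (BoundedContinuousFunction.dist_coe_le_dist x).trans hw.le
  have h1 := abs_le.1 (hclose μ)
  have h2 := abs_le.1 (hclose (ν n))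
  have h3 := abs_lt.1 (hn w hwt)
  have : ∫ x, v x ∂μ - ∫ x, v x ∂(ν n) ≤ ε := by linarith [h1.2, h2.1, h3.2]
  exact_mod_cast this

theorem IsStrict.stronger_wassersteinDivergence {τ : Divergence X} (hτ : IsStrict τ) {K : ℝ≥0}
    (hK : 0 < K) : Stronger τ (wassersteinDivergence X K) := by
  intro ν μ h
  rw [minVal_eq_zero (wassersteinDivergence_self K) (wassersteinDivergence_pos hK)]
  exact tendsto_wassersteinDivergence K (hτ.tendsto h)

end Wasserstein

/-! ### The MMD-GAN objective -/

universe u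

open scoped ComplexOrder in
theorem posSemidef_smul_id {X : Type u} {k : X → X → ℝ} (hk : (Matrix.of k).PosSemidef) :
    (Matrix.of fun x y => k x y • ContinuousLinearMap.id ℝ ℝ).PosSemidef := by
  have hiff := (RKHS.posSemidef_tfae (𝕜 := ℝ)
    (K := Matrix.of fun x y => k x y • ContinuousLinearMap.id ℝ ℝ)).out 0 2
  refine hiff.2 ⟨?_, fun v => ?_⟩
  · ext x y
    have := hk.1.apply y x
    simp only [Matrix.of_apply, star_trivial] at this
    have hid : star (ContinuousLinearMap.id ℝ ℝ) = ContinuousLinearMap.id ℝ ℝ :=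
      star_one (ℝ →L[ℝ] ℝ)
    simp [Matrix.conjTranspose_apply, this, hid]
  · have := hk.2 v
    rw [Finsupp.sum_comm] at this
    simpa [mul_comm, mul_assoc, mul_left_comm] using this

/-- A positive semidefinite kernel is the Gram matrix of a map to a Hilbert space. -/
theorem exists_featureMap {X : Type u} {k : X → X → ℝ} (hk : (Matrix.of k).PosSemidef) :
    ∃ (H : Type u) (_ : NormedAddCommGroup H) (_ : InnerProductSpace ℝ H) (_ : CompleteSpace H)
      (Φ : X → H), ∀ x y, inner ℝ (Φ x) (Φ y) = k x y := by
  have : Fact (Matrix.of fun x y => k x y • ContinuousLinearMap.id ℝ ℝ).PosSemidef :=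
    ⟨posSemidef_smul_id hk⟩
  refine ⟨RKHS.OfKernel (Matrix.of fun x y => k x y • ContinuousLinearMap.id ℝ ℝ), inferInstance,
    inferInstance, inferInstance, fun x => RKHS.kerFun _ x (1 : ℝ), fun x y => ?_⟩
  rw [← RKHS.kernel_inner, RKHS.OfKernel.kernel_ofKernel]
  have := hk.1.apply x y
  simp only [Matrix.of_apply, star_trivial] at this
  simp [this]

section MMD

variable {X : Type u} [MetricSpace X] [CompactSpace X] [MeasurableSpace X] [BorelSpace X]

theorem continuous_featureMap {k : X → X → ℝ} (hk : Continuous fun z : X × X => k z.1 z.2)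
    {H : Type*} [NormedAddCommGroup H] [InnerProductSpace ℝ H] {Φ : X → H}
    (hΦ : ∀ x y, inner ℝ (Φ x) (Φ y) = k x y) : Continuous Φ := by
  refine continuous_iff_continuousAt.2 fun x => tendsto_iff_norm_sub_tendsto_zero.2 ?_
  have h1 : Continuous fun y => k y y - 2 * k y x + k x x := by
    have e1 : Continuous fun y => k y y := hk.comp (continuous_id.prodMk continuous_id)
    have e2 : Continuous fun y => k y x := hk.comp (continuous_id.prodMk continuous_const)
    fun_prop
  have h2 : (fun y => ‖Φ y - Φ x‖) = fun y => √(k y y - 2 * k y x + k x x) := by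
    funext y
    rw [← hΦ, ← hΦ, ← hΦ, real_inner_self_eq_norm_sq, real_inner_self_eq_norm_sq,
      ← norm_sub_sq_real, Real.sqrt_sq (norm_nonneg _)]
  rw [h2]
  have h3 := (Real.continuous_sqrt.comp h1).tendsto x
  have h4 : k x x - 2 * k x x + k x x = 0 := by ring
  simpa only [Function.comp_def, h4, Real.sqrt_zero] using h3

/-- The integral of a vector-valued map against a finite signed measure, through its Jordan
decomposition. -/
def signedMean {H : Type*} [NormedAddCommGroup H] [NormedSpace ℝ H] (s : SignedMeasure X)
    (Φ : X → H) : H :=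
  ∫ x, Φ x ∂s.toJordanDecomposition.posPart - ∫ x, Φ x ∂s.toJordanDecomposition.negPart

section Feature

variable {k : X → X → ℝ} {H : Type*} [NormedAddCommGroup H] [InnerProductSpace ℝ H]
  [CompleteSpace H] {Φ : X → H}

theorem integral_inner_const (hΦc : Continuous Φ) (ρ : Measure X) [IsFiniteMeasure ρ] (w : H) :
    ∫ x, inner ℝ w (Φ x) ∂ρ = inner ℝ w (∫ x, Φ x ∂ρ) :=
  integral_inner (integrable_of_continuous ρ hΦc) w

theorem signedIntegral_inner (hΦc : Continuous Φ) (s : SignedMeasure X) (w : H) :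
    signedIntegral s (fun x => inner ℝ w (Φ x)) = inner ℝ w (signedMean s Φ) := by
  rw [signedIntegral, signedMean, integral_inner_const hΦc, integral_inner_const hΦc,
    inner_sub_right]

theorem signedIntegral_kernel (hΦc : Continuous Φ) (hΦ : ∀ x y, inner ℝ (Φ x) (Φ y) = k x y)
    (s : SignedMeasure X) (x : X) :
    signedIntegral s (k x) = inner ℝ (signedMean s Φ) (Φ x) := by
  rw [real_inner_comm, ← signedIntegral_inner hΦc]
  simp only [hΦ]

/-- In terms of the feature map, the unit ball for `E_{s ⊗ s}[k]` consists of the signed measures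
whose mean embedding lies in the unit ball of the Hilbert space. -/
theorem mmdDivergence_eq (hΦc : Continuous Φ) (hΦ : ∀ x y, inner ℝ (Φ x) (Φ y) = k x y) :
    mmdDivergence k = supDiv (diffClass {v : X → ℝ | ∃ s : SignedMeasure X,
      ‖signedMean s Φ‖ ≤ 1 ∧ v = fun x => inner ℝ (signedMean s Φ) (Φ x)}) := by
  have h1 : ∀ s : SignedMeasure X, signedIntegral s (fun x => signedIntegral s (k x)) ≤ 1 ↔
      ‖signedMean s Φ‖ ≤ 1 := by
    intro s
    simp only [signedIntegral_kernel hΦc hΦ]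
    rw [signedIntegral_inner hΦc, real_inner_self_eq_norm_sq, sq_le_one_iff₀ (norm_nonneg _)]
  unfold mmdDivergence
  congr 1
  ext g
  constructor
  · rintro ⟨s, hs, rfl⟩
    refine ⟨_, ⟨s, (h1 s).1 hs, rfl⟩, ?_⟩
    simp only [signedIntegral_kernel hΦc hΦ]
  · rintro ⟨_, ⟨s, hs, rfl⟩, rfl⟩
    refine ⟨s, (h1 s).2 hs, ?_⟩
    simp only [signedIntegral_kernel hΦc hΦ]

/-- The maximum mean discrepancy is at most the distance of the mean embeddings. -/
theorem mmdDivergence_le (hΦc : Continuous Φ) (hΦ : ∀ x y, inner ℝ (Φ x) (Φ y) = k x y)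
    (μ ν : ProbabilityMeasure X) :
    mmdDivergence k μ ν ≤
      ((‖∫ x, Φ x ∂(μ : Measure X) - ∫ x, Φ x ∂(ν : Measure X)‖ : ℝ) : EReal) := by
  rw [mmdDivergence_eq hΦc hΦ]
  refine supDiv_diffClass_le ?_ ?_
  · rintro _ ⟨s, -, rfl⟩
    fun_prop
  · rintro _ ⟨s, hs, rfl⟩
    rw [integral_inner_const hΦc, integral_inner_const hΦc, ← inner_sub_right]
    have h1 := real_inner_le_norm (signedMean s Φ)
      (∫ x, Φ x ∂(μ : Measure X) - ∫ x, Φ x ∂(ν : Measure X))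
    have h2 := mul_le_mul_of_nonneg_right hs
      (norm_nonneg (∫ x, Φ x ∂(μ : Measure X) - ∫ x, Φ x ∂(ν : Measure X)))
    rw [one_mul] at h2
    exact_mod_cast h1.trans h2

theorem inner_integral_integral (hΦc : Continuous Φ) (hΦ : ∀ x y, inner ℝ (Φ x) (Φ y) = k x y)
    (hk : Continuous fun z : X × X => k z.1 z.2) (μ ν : ProbabilityMeasure X) :
    inner ℝ (∫ x, Φ x ∂(μ : Measure X)) (∫ x, Φ x ∂(ν : Measure X)) =
      ∫ z, k z.1 z.2 ∂((μ : Measure X).prod (ν : Measure X)) := by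
  rw [integral_prod _ (integrable_of_continuous _ hk)]
  simp only [← hΦ]
  simp_rw [integral_inner_const hΦc]
  rw [real_inner_comm, ← integral_inner_const hΦc]
  simp_rw [real_inner_comm]

theorem tendsto_integral_featureMap (hΦc : Continuous Φ)
    (hΦ : ∀ x y, inner ℝ (Φ x) (Φ y) = k x y) (hk : Continuous fun z : X × X => k z.1 z.2)
    {ν : ℕ → ProbabilityMeasure X} {μ : ProbabilityMeasure X} (h : Tendsto ν atTop (𝓝 μ)) :
    Tendsto (fun n => ‖∫ x, Φ x ∂(μ : Measure X) - ∫ x, Φ x ∂(ν n : Measure X)‖) atTop (𝓝 0) := by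
  have h1 : ∀ n, ‖∫ x, Φ x ∂(μ : Measure X) - ∫ x, Φ x ∂(ν n : Measure X)‖ =
      √(∫ z, k z.1 z.2 ∂((μ : Measure X).prod (μ : Measure X)) -
        2 * ∫ z, k z.1 z.2 ∂((μ : Measure X).prod (ν n : Measure X)) +
        ∫ z, k z.1 z.2 ∂((ν n : Measure X).prod (ν n : Measure X))) := by
    intro n
    rw [← inner_integral_integral hΦc hΦ hk, ← inner_integral_integral hΦc hΦ hk,
      ← inner_integral_integral hΦc hΦ hk, real_inner_self_eq_norm_sq, real_inner_self_eq_norm_sq,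
      ← norm_sub_sq_real, Real.sqrt_sq (norm_nonneg _)]
  simp_rw [h1]
  have hJ := continuous_integral_prod hk
  have t1 := (hJ.tendsto (μ, μ)).comp ((tendsto_const_nhds (x := μ)).prodMk_nhds h)
  have t2 := (hJ.tendsto (μ, μ)).comp (h.prodMk_nhds h)
  have t3 := (((tendsto_const_nhds
    (x := ∫ z, k z.1 z.2 ∂((μ : Measure X).prod (μ : Measure X)))).sub
      (t1.const_mul 2)).add t2).sqrt
  refine t3.trans_eq ?_
  congr 1
  rw [Real.sqrt_eq_zero']
  linarith

end Feature

/-- The point mass `c δ_x`, for `c` of either sign. -/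
theorem exists_signedMean_eq_smul {H : Type*} [NormedAddCommGroup H] [NormedSpace ℝ H]
    [CompleteSpace H] (Φ : X → H) (x : X) (c : ℝ) :
    ∃ s : SignedMeasure X, signedMean s Φ = c • Φ x := by
  have key : ∀ c : ℝ≥0, ∃ s : SignedMeasure X, signedMean s Φ = (c : ℝ) • Φ x := by
    intro c
    let j : JordanDecomposition X := ⟨c • Measure.dirac x, 0, Measure.MutuallySingular.zero_right⟩
    refine ⟨j.toSignedMeasure, ?_⟩
    rw [signedMean, JordanDecomposition.toJordanDecomposition_toSignedMeasure]
    simp [j, NNReal.smul_def]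
  rcases le_total 0 c with hc | hc
  · obtain ⟨s, hs⟩ := key c.toNNReal
    exact ⟨s, by rw [hs, Real.coe_toNNReal _ hc]⟩
  · obtain ⟨s, hs⟩ := key (-c).toNNReal
    refine ⟨-s, ?_⟩
    have : signedMean (-s) Φ = -signedMean s Φ := by
      simp [signedMean, SignedMeasure.toJordanDecomposition_neg]
    rw [this, hs, Real.coe_toNNReal _ (neg_nonneg.2 hc), neg_smul, neg_neg]

/-- A universal kernel has a section whose integrals tell two distinct measures apart. -/
theorem IsUniversalKernel.exists_integral_ne {k : X → X → ℝ} (hk : IsUniversalKernel k)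
    {μ ν : ProbabilityMeasure X} (h : μ ≠ ν) : ∃ x, ∫ y, k x y ∂μ ≠ ∫ y, k x y ∂ν := by
  by_contra! hall
  obtain ⟨v, hv⟩ := AdvDiv.exists_integral_ne h
  have hcont : ∀ ρ : ProbabilityMeasure X,
      Continuous fun φ : C(X, ℝ) => ∫ y, φ y ∂(ρ : Measure X) := by
    intro ρ
    refine Metric.continuous_iff.2 fun φ ε hε => ⟨ε, hε, fun ψ hψ => ?_⟩
    rw [dist_eq_norm, ← integral_sub (integrable_of_continuous _ ψ.continuous)
      (integrable_of_continuous _ φ.continuous)]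
    refine (norm_integral_le_of_norm_le_const (C := dist ψ φ) (.of_forall fun x => ?_)).trans_lt
      (by simpa using hψ)
    rw [← dist_eq_norm]
    exact ContinuousMap.dist_apply_le_dist x
  have heq : (fun φ : C(X, ℝ) => ∫ y, φ y ∂(μ : Measure X)) =
      fun φ => ∫ y, φ y ∂(ν : Measure X) := by
    refine (hcont μ).ext_on hk.dense (hcont ν) fun φ hφ => ?_
    refine Submodule.span_induction ?_ (by simp) ?_ ?_ hφ
    · rintro φ ⟨x, hx⟩
      simp only [hx]
      exact hall x
    · intro φ ψ _ _ h1 h2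
      simp only [ContinuousMap.add_apply] at h1 h2 ⊢
      rw [integral_add (integrable_of_continuous _ φ.continuous)
        (integrable_of_continuous _ ψ.continuous), integral_add
        (integrable_of_continuous _ φ.continuous) (integrable_of_continuous _ ψ.continuous), h1, h2]
    · intro c φ _ h1
      simp only [ContinuousMap.smul_apply, integral_smul, h1]
  exact hv (congrFun heq ⟨v, v.continuous⟩)

theorem mmdDivergence_zero_pos_adversarial {k : X → X → ℝ} (hk : IsUniversalKernel k) :
    IsAdversarial (mmdDivergence k) ∧ (∀ μ, mmdDivergence k μ μ = 0) ∧
      ∀ μ ν, μ ≠ ν → 0 < mmdDivergence k μ ν := by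
  obtain ⟨H, _, _, _, Φ, hΦ⟩ := exists_featureMap hk.posSemidef
  have hΦc := continuous_featureMap hk.continuous hΦ
  rw [mmdDivergence_eq hΦc hΦ]
  set V := {v : X → ℝ | ∃ s : SignedMeasure X,
      ‖signedMean s Φ‖ ≤ 1 ∧ v = fun x => inner ℝ (signedMean s Φ) (Φ x)} with hV
  have hVc : ∀ v ∈ V, Continuous v := by
    rintro _ ⟨s, -, rfl⟩
    fun_prop
  have hne : V.Nonempty :=
    ⟨_, 0, by simp [signedMean, SignedMeasure.toJordanDecomposition_zero], rfl⟩
  refine ⟨diffClass_isAdversarial hne hVc, supDiv_diffClass_self hne hVc,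
    supDiv_diffClass_pos hVc fun μ ν h => ?_⟩
  obtain ⟨x, hx⟩ := hk.exists_integral_ne h
  -- the test function is `c k(x, ·)`, with `c` small enough and of the right sign
  have key : ∀ σ : ℝ, |σ| = 1 → ∃ c > 0, (fun y => σ * c * k x y) ∈ V := by
    intro σ hσ
    have hc : 0 < (‖Φ x‖ + 1)⁻¹ := by positivity
    obtain ⟨s, hs⟩ := exists_signedMean_eq_smul Φ x (σ * (‖Φ x‖ + 1)⁻¹)
    refine ⟨_, hc, s, ?_, ?_⟩
    · rw [hs, norm_smul, Real.norm_eq_abs, abs_mul, hσ, one_mul, abs_of_pos hc,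
        inv_mul_le_iff₀ (by positivity)]
      linarith
    · simp only [hs, inner_smul_left, hΦ]
      simp
  rcases hx.lt_or_gt with h' | h'
  · obtain ⟨c, hc, hmem⟩ := key (-1) (by simp)
    refine ⟨_, hmem, ?_⟩
    simp only [integral_const_mul]
    nlinarith
  · obtain ⟨c, hc, hmem⟩ := key 1 (by simp)
    refine ⟨_, hmem, ?_⟩
    simp only [integral_const_mul]
    nlinarith

theorem isStrict_mmdDivergence {k : X → X → ℝ} (hk : IsUniversalKernel k) :
    IsStrict (mmdDivergence k) :=
  have h := mmdDivergence_zero_pos_adversarial hk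
  isStrict_of_pos h.1 h.2.1 h.2.2

theorem IsStrict.stronger_mmdDivergence {τ : Divergence X} (hτ : IsStrict τ) {k : X → X → ℝ}
    (hk : IsUniversalKernel k) : Stronger τ (mmdDivergence k) := by
  intro ν μ h
  obtain ⟨-, h0, hpos⟩ := mmdDivergence_zero_pos_adversarial hk
  rw [minVal_eq_zero h0 hpos]
  obtain ⟨H, _, _, _, Φ, hΦ⟩ := exists_featureMap hk.posSemidef
  have hΦc := continuous_featureMap hk.continuous hΦ
  have ht := tendsto_integral_featureMap hΦc hΦ hk.continuous (hτ.tendsto h)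
  refine tendsto_zero_of_eventually_le (fun n => ?_) fun ε hε => ?_
  · rw [← minVal_eq_zero h0 hpos μ]
    exact iInf_le _ _
  · filter_upwards [ht.eventually_lt_const hε] with n hn
    exact (mmdDivergence_le hΦc hΦ _ _).trans (by exact_mod_cast hn.le)

end MMD

/-! ### f-GAN objectives with an explicit conjugate -/

theorem conj_le {f : ℝ → EReal} {t : ℝ} {a : EReal}
    (h : ∀ x : ℝ, ((t * x : ℝ) : EReal) - f x ≤ a) : conj f t ≤ a := iSup_le h

theorem le_conj (f : ℝ → EReal) (t x : ℝ) : ((t * x : ℝ) : EReal) - f x ≤ conj f t :=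
  le_iSup (fun x : ℝ => ((t * x : ℝ) : EReal) - f x) x

theorem conj_eq_top {f : ℝ → EReal} {t : ℝ}
    (h : ∀ y : ℝ, ∃ x : ℝ, (y : EReal) ≤ ((t * x : ℝ) : EReal) - f x) : conj f t = ⊤ := by
  refine EReal.eq_top_iff_forall_lt _ |>.2 fun y => ?_
  obtain ⟨x, hx⟩ := h (y + 1)
  refine lt_of_lt_of_le ?_ (hx.trans (le_conj f t x))
  exact_mod_cast lt_add_one y

/-- The conjugate of `f` is finite exactly on `D`, where it is the continuous function `φ`. It lies
above the diagonal (a consequence of `f 1 = 0`), and is quadratically close to the diagonal around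
some interior point `t₀` of `D`: if `f` is smooth at `1` with positive second derivative, then
`t₀ = f' 1`, and if `f` has a kink at `1`, then `t₀` lies between its one-sided derivatives. -/
structure HasConj (f : ℝ → EReal) (D : Set ℝ) (φ : ℝ → ℝ) : Prop where
  eq_coe : ∀ t ∈ D, conj f t = φ t
  eq_top : ∀ t, t ∉ D → conj f t = ⊤
  continuousOn : ContinuousOn φ D
  self_le : ∀ t ∈ D, t ≤ φ t
  tangent : ∃ t₀ δ C : ℝ, 0 < δ ∧ 0 ≤ C ∧
    ∀ u, |u| ≤ δ → t₀ + u ∈ D ∧ φ (t₀ + u) ≤ t₀ + u + C * u ^ 2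

namespace HasConj

variable {f : ℝ → EReal} {D : Set ℝ} {φ : ℝ → ℝ}

section

variable {X : Type*} [MetricSpace X] [CompactSpace X]

theorem continuous_comp (h : HasConj f D φ) {v : X → ℝ} (hv : Continuous v) (hD : ∀ x, v x ∈ D) :
    Continuous fun x => φ (v x) :=
  h.continuousOn.comp_continuous hv hD

theorem mem_of_lt_top (h : HasConj f D φ) {t : ℝ} (ht : conj f t < ⊤) : t ∈ D := by
  by_contra hD
  exact ht.ne (h.eq_top t hD)

theorem exists_mem (h : HasConj f D φ) : ∃ t ∈ D, φ t = t := by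
  obtain ⟨t₀, δ, C, hδ, -, ht⟩ := h.tangent
  obtain ⟨hD, hle⟩ := ht 0 (by simpa using hδ.le)
  simp only [add_zero, ne_eq, OfNat.ofNat_ne_zero, not_false_eq_true, zero_pow, mul_zero] at hD hle
  exact ⟨t₀, hD, hle.antisymm (h.self_le _ hD)⟩

theorem fGANClass_eq (h : HasConj f D φ) : fGANClass X f =
    {g | ∃ v : X → ℝ, Continuous v ∧ (∀ x, v x ∈ D) ∧ g = fun z => v z.1 - φ (v z.2)} := by
  ext g
  constructor
  · rintro ⟨v, hv, rfl⟩
    have hD : ∀ x, v x ∈ D := fun x => h.mem_of_lt_top (hv x)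
    refine ⟨v, v.continuous, hD, ?_⟩
    simp only [h.eq_coe _ (hD _), EReal.toReal_coe]
  · rintro ⟨v, hv, hD, rfl⟩
    refine ⟨.mkOfCompact ⟨v, hv⟩, fun x => ?_, ?_⟩
    · simp only [BoundedContinuousFunction.mkOfCompact_apply, ContinuousMap.coe_mk,
        h.eq_coe _ (hD x)]
      exact EReal.coe_lt_top _
    · simp only [BoundedContinuousFunction.mkOfCompact_apply, ContinuousMap.coe_mk,
        h.eq_coe _ (hD _), EReal.toReal_coe]

end

variable {X : Type*} [MetricSpace X] [CompactSpace X] [MeasurableSpace X] [BorelSpace X]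

theorem le_fGAN (h : HasConj f D φ) {v : X → ℝ} (hv : Continuous v) (hD : ∀ x, v x ∈ D)
    (μ ν : ProbabilityMeasure X) :
    ((∫ x, v x ∂μ - ∫ x, φ (v x) ∂ν : ℝ) : EReal) ≤ fGAN X f μ ν := by
  rw [← integral_prod_sub μ ν hv (h.continuous_comp hv hD)]
  exact le_supDiv (by rw [h.fGANClass_eq]; exact ⟨v, hv, hD, rfl⟩) μ ν

theorem fGAN_le (h : HasConj f D φ) {μ ν : ProbabilityMeasure X} {a : EReal}
    (ha : ∀ v : X → ℝ, Continuous v → (∀ x, v x ∈ D) →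
      ((∫ x, v x ∂μ - ∫ x, φ (v x) ∂ν : ℝ) : EReal) ≤ a) : fGAN X f μ ν ≤ a := by
  unfold fGAN
  rw [h.fGANClass_eq]
  refine iSup₂_le ?_
  rintro _ ⟨v, hv, hD, rfl⟩
  rw [integral_prod_sub μ ν hv (h.continuous_comp hv hD)]
  exact ha v hv hD

theorem isAdversarial (h : HasConj f D φ) : IsAdversarial (fGAN X f) := by
  unfold fGAN
  rw [h.fGANClass_eq]
  obtain ⟨t, ht, -⟩ := h.exists_mem
  refine isAdversarial_of_continuous ⟨_, fun _ => t, continuous_const, fun _ => ht, rfl⟩ ?_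
  rintro _ ⟨v, hv, hD, rfl⟩
  exact (hv.comp continuous_fst).sub ((h.continuous_comp hv hD).comp continuous_snd)

theorem fGAN_nonneg (h : HasConj f D φ) (μ ν : ProbabilityMeasure X) : 0 ≤ fGAN X f μ ν := by
  obtain ⟨t, ht, hφ⟩ := h.exists_mem
  simpa [hφ] using h.le_fGAN (X := X) (v := fun _ => t) continuous_const (fun _ => ht) μ ν

theorem fGAN_self (h : HasConj f D φ) (μ : ProbabilityMeasure X) : fGAN X f μ μ = 0 := by
  refine le_antisymm (h.fGAN_le fun v hv hD => ?_) (h.fGAN_nonneg μ μ)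
  have : ∫ x, v x ∂μ ≤ ∫ x, φ (v x) ∂(μ : Measure X) :=
    integral_mono (integrable_of_continuous _ hv)
      (integrable_of_continuous _ (h.continuous_comp hv hD)) fun x => h.self_le _ (hD x)
  exact_mod_cast sub_nonpos.2 this

/-- Testing with `t₀ + s v`, where `t₀` is the point of contact of `φ` with the diagonal, bounds the
objective from below by the total variation up to a quadratic error. -/
theorem exists_le_fGAN (h : HasConj f D φ) : ∃ δ C : ℝ, 0 < δ ∧ 0 ≤ C ∧
    ∀ (μ ν : ProbabilityMeasure X) (v : X → ℝ), Continuous v → (∀ x, |v x| ≤ 1 / 2) →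
      ∀ s, 0 < s → s ≤ δ →
        ((s * (∫ x, v x ∂μ - ∫ x, v x ∂ν) - C * s ^ 2 : ℝ) : EReal) ≤ fGAN X f μ ν := by
  obtain ⟨t₀, δ, C, hδ, hC, ht⟩ := h.tangent
  refine ⟨δ, C, hδ, hC, fun μ ν v hv hv1 s hs hsδ => ?_⟩
  have hu : ∀ x, |s * v x| ≤ s := fun x => by
    rw [abs_mul, abs_of_pos hs]
    nlinarith [hv1 x]
  have hD : ∀ x, t₀ + s * v x ∈ D := fun x => (ht _ ((hu x).trans hsδ)).1
  have hc : Continuous fun x => t₀ + s * v x := by fun_prop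
  refine le_trans ?_ (h.le_fGAN hc hD μ ν)
  have h1 : ∫ x, φ (t₀ + s * v x) ∂(ν : Measure X) ≤
      ∫ x, (t₀ + s * v x + C * s ^ 2) ∂(ν : Measure X) := by
    refine integral_mono (integrable_of_continuous _ (h.continuous_comp hc hD))
      (integrable_of_continuous _ (by fun_prop)) fun x => ?_
    refine (ht _ ((hu x).trans hsδ)).2.trans ?_
    have : (s * v x) ^ 2 ≤ s ^ 2 := sq_le_sq' (by linarith [(abs_le.1 (hu x)).1])
      (abs_le.1 (hu x)).2
    gcongr
  have h2 : ∀ ρ : ProbabilityMeasure X,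
      ∫ x, (t₀ + s * v x) ∂(ρ : Measure X) = t₀ + s * ∫ x, v x ∂ρ := fun ρ => by
    rw [integral_add (integrable_const _) (integrable_of_continuous _ (by fun_prop)),
      integral_const_mul]
    simp
  rw [integral_add (integrable_of_continuous _ hc) (integrable_const _), h2] at h1
  rw [h2]
  simp only [integral_const, probReal_univ, one_smul] at h1
  exact_mod_cast (by linarith : s * (∫ x, v x ∂μ - ∫ x, v x ∂ν) - C * s ^ 2 ≤
    t₀ + s * ∫ x, v x ∂μ - ∫ x, φ (t₀ + s * v x) ∂(ν : Measure X))

theorem fGAN_pos (h : HasConj f D φ) (μ ν : ProbabilityMeasure X) (hne : μ ≠ ν) :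
    0 < fGAN X f μ ν := by
  obtain ⟨δ, C, hδ, hC, hle⟩ := h.exists_le_fGAN (X := X)
  obtain ⟨w, hw⟩ := exists_integral_lt hne
  obtain ⟨v, hvc, hv1, hv⟩ : ∃ v : X → ℝ, Continuous v ∧ (∀ x, |v x| ≤ 1 / 2) ∧
      ∫ x, v x ∂ν < ∫ x, v x ∂μ := by
    have hpos : 0 < (2 * (‖w‖ + 1))⁻¹ := by positivity
    refine ⟨fun x => (2 * (‖w‖ + 1))⁻¹ * w x, by fun_prop, fun x => ?_, ?_⟩
    · rw [abs_mul, abs_of_pos hpos, inv_mul_le_iff₀ (by positivity)]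
      have := w.norm_coe_le_norm x
      rw [Real.norm_eq_abs] at this
      linarith
    · rw [integral_const_mul, integral_const_mul]
      exact mul_lt_mul_of_pos_left hw hpos
  set d := ∫ x, v x ∂μ - ∫ x, v x ∂ν with hd
  have hdpos : 0 < d := sub_pos.2 hv
  set s := min δ (d / (2 * (C + 1))) with hs
  have hspos : 0 < s := lt_min hδ (by positivity)
  refine lt_of_lt_of_le ?_ (hle μ ν v hvc hv1 s hspos (min_le_left _ _))
  have h1 : s * (2 * (C + 1)) ≤ d := by
    rw [← le_div_iff₀ (by positivity)]
    exact min_le_right _ _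
  have : 0 < s * d - C * s ^ 2 := by nlinarith [mul_pos hspos hdpos, mul_nonneg hC hspos.le]
  exact_mod_cast this

theorem isStrict (h : HasConj f D φ) : IsStrict (fGAN X f) :=
  isStrict_of_pos h.isAdversarial h.fGAN_self h.fGAN_pos

theorem minVal_eq (h : HasConj f D φ) (μ : ProbabilityMeasure X) : minVal (fGAN X f) μ = 0 :=
  minVal_eq_zero h.fGAN_self h.fGAN_pos μ

end HasConj

/-! ### The conjugates -/

theorem hasConj_fKL : HasConj fKL Set.univ fun t => Real.exp (t - 1) where
  eq_coe t _ := by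
    refine le_antisymm (conj_le fun x => ?_) ?_
    · unfold fKL
      split_ifs with hx
      · rw [← EReal.coe_sub, EReal.coe_le_coe_iff]
        rcases hx.eq_or_lt with rfl | hx
        · simpa using (Real.exp_pos _).le
        · have h1 := Real.add_one_le_exp (t - 1 - Real.log x)
          rw [Real.exp_sub, Real.exp_log hx, le_div_iff₀ hx] at h1
          linarith
      · simp
    · refine le_trans (le_of_eq ?_) (le_conj fKL t (Real.exp (t - 1)))
      rw [fKL, if_pos (Real.exp_pos _).le, ← EReal.coe_sub, Real.log_exp]
      congr 1
      ring
  eq_top t ht := absurd trivial ht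
  continuousOn := by fun_prop
  self_le t _ := by linarith [Real.add_one_le_exp (t - 1)]
  tangent := by
    refine ⟨1, 1, 1, one_pos, zero_le_one, fun u hu => ⟨trivial, ?_⟩⟩
    have := (abs_le.1 (Real.abs_exp_sub_one_sub_id_le hu)).2
    simp only [add_sub_cancel_left]
    linarith

/-- On `[-1/2, 1/2]`, the function `u / (1 - u)` is quadratically close to `u`. -/
theorem div_one_sub_le {u : ℝ} (hu : |u| ≤ 1 / 2) : u / (1 - u) ≤ u + 2 * u ^ 2 := by
  have h := abs_le.1 hu
  rw [div_le_iff₀ (by linarith)]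
  nlinarith [sq_nonneg u, mul_nonneg (sq_nonneg u) (by linarith : 0 ≤ 1 - 2 * u)]

theorem neg_log_one_sub_le {u : ℝ} (hu : |u| ≤ 1 / 2) : -Real.log (1 - u) ≤ u + 2 * u ^ 2 := by
  have h := abs_le.1 hu
  have hpos : 0 < 1 - u := by linarith
  refine le_trans ?_ (div_one_sub_le hu)
  have := Real.log_le_sub_one_of_pos (inv_pos.2 hpos)
  rw [Real.log_inv] at this
  refine this.trans (le_of_eq ?_)
  field_simp
  ring

theorem hasConj_fRKL : HasConj fRKL (Set.Iio 0) fun t => -1 - Real.log (-t) where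
  eq_coe t ht := by
    have ht : 0 < -t := by simpa using ht
    refine le_antisymm (conj_le fun x => ?_) ?_
    · unfold fRKL
      split_ifs with hx
      · rw [← EReal.coe_sub, EReal.coe_le_coe_iff]
        have h1 := Real.log_le_sub_one_of_pos (mul_pos ht hx)
        rw [Real.log_mul ht.ne' hx.ne'] at h1
        linarith
      · simp
    · refine le_trans (le_of_eq ?_) (le_conj fRKL t (-t)⁻¹)
      rw [fRKL, if_pos (inv_pos.2 ht), ← EReal.coe_sub, Real.log_inv]
      congr 1
      have : t * (-t)⁻¹ = -1 := by
        rw [inv_neg, mul_neg, mul_inv_cancel₀ (neg_pos.1 ht).ne]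
      rw [this]
      ring
  eq_top t ht := by
    have ht : 0 ≤ t := by simpa using ht
    refine conj_eq_top fun y => ⟨Real.exp y, ?_⟩
    rw [fRKL, if_pos (Real.exp_pos _), ← EReal.coe_sub, EReal.coe_le_coe_iff, Real.log_exp]
    linarith [mul_nonneg ht (Real.exp_pos y).le]
  continuousOn := by
    refine continuousOn_const.sub (ContinuousOn.log (by fun_prop) fun t ht => ?_)
    have : t < 0 := ht
    linarith
  self_le t ht := by
    have ht : 0 < -t := by simpa using ht
    linarith [Real.log_le_sub_one_of_pos ht]
  tangent := by
    refine ⟨-1, 1 / 2, 2, by norm_num, by norm_num, fun u hu => ⟨?_, ?_⟩⟩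
    · have := (abs_le.1 hu).2
      simp only [Set.mem_Iio]
      linarith
    · have := neg_log_one_sub_le hu
      have e : -(-1 + u) = 1 - u := by ring
      simp only [e]
      linarith

theorem hasConj_fTV : HasConj fTV (Set.Icc (-(1 / 2)) (1 / 2)) id where
  eq_coe t ht := by
    refine le_antisymm (conj_le fun x => ?_) ?_
    · unfold fTV
      rw [← EReal.coe_sub, EReal.coe_le_coe_iff]
      have h1 := abs_le.2 ht
      have h2 := (le_abs_self (t * (x - 1))).trans_eq (abs_mul _ _)
      have h3 := mul_le_mul_of_nonneg_right h1 (abs_nonneg (x - 1))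
      simp only [id]
      linarith
    · refine le_trans (le_of_eq ?_) (le_conj fTV t 1)
      simp [fTV]
  eq_top t ht := by
    have ht : 0 < |t| - 1 / 2 := by
      by_contra hcon
      exact ht (abs_le.1 (by linarith))
    refine conj_eq_top fun y => ?_
    -- far out in the direction in which `t x` increases
    obtain ⟨σ, hσ, hσt⟩ : ∃ σ : ℝ, |σ| = 1 ∧ σ * t = |t| := by
      rcases le_total 0 t with h | h
      · exact ⟨1, by simp, by rw [abs_of_nonneg h, one_mul]⟩
      · exact ⟨-1, by simp, by rw [abs_of_nonpos h]; ring⟩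
    refine ⟨1 + σ * (|y - t| / (|t| - 1 / 2)), ?_⟩
    have h1 : |y - t| / (|t| - 1 / 2) * (|t| - 1 / 2) = |y - t| := div_mul_cancel₀ _ ht.ne'
    have h2 := le_abs_self (y - t)
    have hr : 0 ≤ |y - t| / (|t| - 1 / 2) := div_nonneg (abs_nonneg _) ht.le
    set r := |y - t| / (|t| - 1 / 2)
    unfold fTV
    rw [← EReal.coe_sub, EReal.coe_le_coe_iff, add_sub_cancel_left, abs_mul, hσ, one_mul,
      abs_of_nonneg hr]
    have : t * (1 + σ * r) = t + |t| * r := by rw [← hσt]; ring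
    rw [this]
    linarith
  continuousOn := continuousOn_id
  self_le t _ := le_rfl
  tangent := by
    refine ⟨0, 1 / 2, 0, by norm_num, le_rfl, fun u hu => ⟨?_, ?_⟩⟩
    · rw [zero_add]
      exact abs_le.1 hu
    · simp

theorem exp_lt_two_of_lt {t : ℝ} (ht : t < Real.log 2) : 0 < 2 - Real.exp t := by
  have := (Real.lt_log_iff_exp_lt two_pos).1 ht
  linarith

theorem hasConj_fJS :
    HasConj fJS (Set.Iio (Real.log 2)) fun t => -Real.log (2 - Real.exp t) where
  eq_coe t ht := by
    have hpos := exp_lt_two_of_lt ht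
    refine le_antisymm (conj_le fun x => ?_) ?_
    · unfold fJS
      split_ifs with hx
      · rw [← EReal.coe_sub, EReal.coe_le_coe_iff]
        have ha : 0 < (x + 1) / 2 := by linarith
        have h2 := Real.log_le_sub_one_of_pos (mul_pos hpos ha)
        rw [Real.log_mul hpos.ne' ha.ne'] at h2
        rcases hx.eq_or_lt with rfl | hx
        · simp only [zero_add, Real.log_zero] at h2 ⊢
          nlinarith [Real.exp_pos t]
        · -- the inequality `log y ≤ y - 1`, weighted by `x` and by `1`
          have h1 := Real.log_le_sub_one_of_pos (div_pos (mul_pos (Real.exp_pos t) ha) hx)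
          rw [Real.log_div (by positivity) hx.ne', Real.log_mul (by positivity) ha.ne',
            Real.log_exp] at h1
          have h3 := mul_le_mul_of_nonneg_left h1 hx.le
          have h4 : x * (Real.exp t * ((x + 1) / 2) / x - 1) = Real.exp t * ((x + 1) / 2) - x := by
            field_simp
          rw [h4] at h3
          linarith
      · simp
    · have hx : 0 < Real.exp t / (2 - Real.exp t) := div_pos (Real.exp_pos _) hpos
      refine le_trans (le_of_eq ?_) (le_conj fJS t (Real.exp t / (2 - Real.exp t)))
      have h1 : (Real.exp t / (2 - Real.exp t) + 1) / 2 = (2 - Real.exp t)⁻¹ := by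
        field_simp
        ring
      rw [fJS, if_pos hx.le, ← EReal.coe_sub, h1, Real.log_inv,
        Real.log_div (Real.exp_pos _).ne' hpos.ne', Real.log_exp]
      congr 1
      ring
  eq_top t ht := by
    have ht : Real.log 2 ≤ t := by simpa using ht
    refine conj_eq_top fun y => ⟨Real.exp (y + Real.log 2), ?_⟩
    set x := Real.exp (y + Real.log 2) with hxdef
    have hx : 0 < x := Real.exp_pos _
    rw [fJS, if_pos hx.le, ← EReal.coe_sub, EReal.coe_le_coe_iff,
      Real.log_div (by positivity) two_ne_zero]
    have h1 : y + Real.log 2 = Real.log x := (Real.log_exp _).symm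
    have h2 : Real.log x ≤ Real.log (x + 1) := Real.log_le_log hx (by linarith)
    have h3 := mul_le_mul_of_nonneg_right ht hx.le
    have h4 := mul_le_mul_of_nonneg_left h2 hx.le
    linarith
  continuousOn := by
    refine (ContinuousOn.log (by fun_prop) fun t ht => ?_).neg
    exact (exp_lt_two_of_lt ht).ne'
  self_le t ht := by
    have hpos := exp_lt_two_of_lt ht
    have h1 := Real.log_le_sub_one_of_pos (mul_pos hpos (Real.exp_pos t))
    rw [Real.log_mul hpos.ne' (Real.exp_pos _).ne', Real.log_exp] at h1
    nlinarith [sq_nonneg (Real.exp t - 1)]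
  tangent := by
    refine ⟨0, 1 / 4, 9, by norm_num, by norm_num, fun u hu => ?_⟩
    have h1 := abs_le.1 (Real.abs_exp_sub_one_sub_id_le (hu.trans (by norm_num)))
    have h2 := abs_le.1 hu
    set y := Real.exp u - 1 with hy
    have hy2 : |y| ≤ 2 * |u| := by
      rw [abs_le]
      rcases abs_cases u with ⟨h, _⟩ | ⟨h, _⟩ <;> rw [h] <;> constructor <;> nlinarith
    have hy3 : |y| ≤ 1 / 2 := by linarith
    have hysq : y ^ 2 ≤ 4 * u ^ 2 := by
      rw [← sq_abs y, ← sq_abs u]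
      nlinarith [abs_nonneg y, abs_nonneg u]
    rw [zero_add]
    refine ⟨?_, ?_⟩
    · rw [Set.mem_Iio, Real.lt_log_iff_exp_lt two_pos]
      linarith [(abs_le.1 hy3).2]
    · have h3 := neg_log_one_sub_le hy3
      have e : 2 - Real.exp u = 1 - y := by rw [hy]; ring
      simp only [e]
      linarith

theorem hasConj_fHellinger : HasConj fHellinger (Set.Iio 1) fun t => t / (1 - t) where
  eq_coe t ht := by
    have ht : 0 < 1 - t := by simpa using ht
    refine le_antisymm (conj_le fun x => ?_) ?_
    · unfold fHellinger
      split_ifs with hx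
      · rw [← EReal.coe_sub, EReal.coe_le_coe_iff, le_div_iff₀ ht]
        obtain ⟨r, rfl⟩ : ∃ r, x = r ^ 2 := ⟨√x, (Real.sq_sqrt hx).symm⟩
        rw [Real.sqrt_sq_eq_abs, ← sq_abs r]
        nlinarith [sq_nonneg ((1 - t) * |r| - 1)]
      · simp
    · refine le_trans (le_of_eq ?_) (le_conj fHellinger t ((1 - t)⁻¹ ^ 2))
      rw [fHellinger, if_pos (by positivity), ← EReal.coe_sub, Real.sqrt_sq (by positivity)]
      congr 1
      field_simp
      ring
  eq_top t ht := by
    have ht : 1 ≤ t := by simpa using ht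
    refine conj_eq_top fun y => ⟨(|y| + 1) ^ 2, ?_⟩
    rw [fHellinger, if_pos (by positivity), ← EReal.coe_sub, EReal.coe_le_coe_iff,
      Real.sqrt_sq (by positivity)]
    nlinarith [le_abs_self y, abs_nonneg y, sq_nonneg (|y| + 1)]
  continuousOn := by
    refine ContinuousOn.div (by fun_prop) (by fun_prop) fun t ht => ?_
    have : t < 1 := ht
    linarith
  self_le t ht := by
    have ht : 0 < 1 - t := by simpa using ht
    rw [le_div_iff₀ ht]
    nlinarith [sq_nonneg t]
  tangent := by
    refine ⟨0, 1 / 2, 2, by norm_num, by norm_num, fun u hu => ?_⟩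
    rw [zero_add]
    refine ⟨?_, div_one_sub_le hu⟩
    have := (abs_le.1 hu).2
    simp only [Set.mem_Iio]
    linarith

/-! ### Comparison with the total variation -/

section Compare

variable {X : Type*} [MetricSpace X] [CompactSpace X] [MeasurableSpace X] [BorelSpace X]
variable {f : ℝ → EReal} {D : Set ℝ} {φ : ℝ → ℝ}

theorem HasConj.stronger_tvDivergence (h : HasConj f D φ) :
    Stronger (fGAN X f) (tvDivergence X) := by
  intro ν μ ht
  rw [h.minVal_eq] at ht
  rw [tvDivergence, hasConj_fTV.minVal_eq]
  obtain ⟨δ, C, hδ, hC, hle⟩ := h.exists_le_fGAN (X := X)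
  refine tendsto_zero_of_eventually_le (fun n => hasConj_fTV.fGAN_nonneg _ _) fun ε hε => ?_
  set s := min δ (ε / (2 * (C + 1))) with hs
  have hspos : 0 < s := lt_min hδ (by positivity)
  have hsε : s * (2 * (C + 1)) ≤ ε := by
    rw [← le_div_iff₀ (by positivity)]
    exact min_le_right _ _
  filter_upwards [eventually_lt_of_tendsto_zero ht (ε := s * (ε / 2)) (by positivity)] with n hn
  refine hasConj_fTV.fGAN_le fun v hv hv1 => ?_
  have h1 := (hle μ (ν n) v hv (fun x => abs_le.2 (hv1 x)) s hspos (min_le_left _ _)).trans_lt hn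
  rw [EReal.coe_lt_coe_iff] at h1
  have h2 : s * (∫ x, v x ∂μ - ∫ x, v x ∂(ν n)) < s * (ε / 2 + C * s) := by linarith
  have h3 := lt_of_mul_lt_mul_left h2 hspos.le
  have : ∫ x, v x ∂μ - ∫ x, v x ∂(ν n) ≤ ε := by linarith
  exact_mod_cast this

/-- If the conjugate of `f` has a domain bounded above and is bounded below by its limit at `-∞`,
then test functions may be truncated from below at a small cost, and the truncated ones are
controlled by the total variation. -/
theorem HasConj.tvDivergence_stronger (h : HasConj f D φ) {B L : ℝ} (hB : ∀ t ∈ D, t ≤ B)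
    (hL : ∀ t ∈ D, L ≤ φ t) (hneg : ∀ t ≤ 0, t ∈ D)
    (hlim : Tendsto (fun M => φ (-M)) atTop (𝓝 L)) :
    Stronger (tvDivergence X) (fGAN X f) := by
  intro ν μ ht
  rw [tvDivergence, hasConj_fTV.minVal_eq] at ht
  rw [h.minVal_eq]
  refine tendsto_zero_of_eventually_le (fun n => h.fGAN_nonneg _ _) fun ε hε => ?_
  obtain ⟨M, hMφ, hMB, hM0⟩ := ((hlim.eventually_lt_const
    (by linarith : L < L + ε / 2)).and ((eventually_ge_atTop B).and (eventually_gt_atTop 0))).exists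
  filter_upwards [eventually_lt_of_tendsto_zero ht (ε := ε / 2 / (2 * M)) (by positivity)]
    with n hn
  refine h.fGAN_le fun v hv hD => ?_
  set w : X → ℝ := fun x => max (v x) (-M) with hw
  have hwc : Continuous w := by fun_prop
  have h1 : ∫ x, w x ∂μ - ∫ x, w x ∂(ν n) ≤ ε / 2 := by
    have hwb : ∀ x, (2 * M)⁻¹ * w x ∈ Set.Icc (-(1 / 2) : ℝ) (1 / 2) := by
      intro x
      have e1 : -M ≤ w x := le_max_right _ _
      have e2 : w x ≤ M := max_le ((hB _ (hD x)).trans hMB) (by linarith)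
      refine abs_le.1 ?_
      rw [abs_mul, abs_of_pos (by positivity), inv_mul_le_iff₀ (by positivity), abs_le]
      constructor <;> linarith
    have e := (hasConj_fTV.le_fGAN (v := fun x => (2 * M)⁻¹ * w x) (by fun_prop) hwb
      μ (ν n)).trans_lt hn
    simp only [id, integral_const_mul] at e
    rw [EReal.coe_lt_coe_iff, ← mul_sub, inv_mul_lt_iff₀ (by positivity),
      mul_div_cancel₀ _ (by positivity)] at e
    exact e.le
  have h2 : ∫ x, v x ∂μ ≤ ∫ x, w x ∂μ := integral_mono (integrable_of_continuous _ hv)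
    (integrable_of_continuous _ hwc) fun x => le_max_left _ _
  have h3 : ∫ x, w x ∂(ν n) ≤ ∫ x, (φ (v x) + ε / 2) ∂(ν n : Measure X) := by
    refine integral_mono (integrable_of_continuous _ hwc)
      ((integrable_of_continuous _ (h.continuous_comp hv hD)).add (integrable_const _)) fun x => ?_
    refine max_le ?_ ?_
    · linarith [h.self_le _ (hD x)]
    · linarith [h.self_le _ (hneg (-M) (by linarith)), hL _ (hD x)]
  rw [integral_add (integrable_of_continuous _ (h.continuous_comp hv hD)) (integrable_const _)]
    at h3
  simp only [integral_const, probReal_univ, one_smul] at h3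
  exact_mod_cast (by linarith : ∫ x, v x ∂μ - ∫ x, φ (v x) ∂(ν n : Measure X) ≤ ε)

theorem tvDivergence_stronger_jsDivergence : Stronger (tvDivergence X) (jsDivergence X) := by
  refine hasConj_fJS.tvDivergence_stronger (B := Real.log 2) (L := -Real.log 2)
    (fun t ht => le_of_lt ht) (fun t ht => ?_) (fun t ht => ?_) ?_
  · exact neg_le_neg (Real.log_le_log (exp_lt_two_of_lt ht) (by linarith [Real.exp_pos t]))
  · exact ht.trans_lt (Real.log_pos one_lt_two)
  · have h1 : Tendsto (fun M : ℝ => 2 - Real.exp (-M)) atTop (𝓝 2) := by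
      simpa using (tendsto_const_nhds (x := (2 : ℝ))).sub Real.tendsto_exp_neg_atTop_nhds_zero
    exact (h1.log two_ne_zero).neg

theorem tvDivergence_stronger_hellingerDivergence :
    Stronger (tvDivergence X) (hellingerDivergence X) := by
  refine hasConj_fHellinger.tvDivergence_stronger (B := 1) (L := -1)
    (fun t ht => le_of_lt ht) (fun t ht => ?_) (fun t ht => ?_) ?_
  · have ht : 0 < 1 - t := by simpa using ht
    rw [le_div_iff₀ ht]
    linarith
  · exact ht.trans_lt one_pos
  · have h1 : Tendsto (fun M : ℝ => -1 + (1 + M)⁻¹) atTop (𝓝 (-1)) := by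
      simpa using (tendsto_const_nhds (x := (-1 : ℝ))).add
        (tendsto_inv_atTop_zero.comp (tendsto_atTop_add_const_left atTop (1 : ℝ) tendsto_id))
    refine h1.congr' ?_
    filter_upwards [eventually_ge_atTop 0] with M hM
    have : 1 + M ≠ 0 := by positivity
    rw [sub_neg_eq_add]
    field_simp
    ring

end Compare

/-! ### Strictness of the hierarchy on infinite spaces -/

section Infinite

variable {X : Type*} [MetricSpace X] [CompactSpace X] [MeasurableSpace X] [BorelSpace X]

/-- If `ν` keeps a fraction `c` of `μ`, then the Kullback–Leibler divergence is at most `-log c`. -/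
theorem klDivergence_le {μ ν : ProbabilityMeasure X} {c : ℝ} (hc : 0 < c)
    (h : ENNReal.ofReal c • (μ : Measure X) ≤ ν) :
    klDivergence X μ ν ≤ ((-Real.log c : ℝ) : EReal) := by
  refine hasConj_fKL.fGAN_le fun v hv _ => ?_
  have hec : Continuous fun x => Real.exp (v x - 1) := by fun_prop
  have h1 : c * ∫ x, Real.exp (v x - 1) ∂μ ≤ ∫ x, Real.exp (v x - 1) ∂(ν : Measure X) := by
    have := integral_mono_measure h (.of_forall fun x => (Real.exp_pos (v x - 1)).le)
      (integrable_of_continuous _ hec)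
    rwa [integral_smul_measure, ENNReal.toReal_ofReal hc.le, smul_eq_mul] at this
  have h2 : ∫ x, v x ∂μ ≤ ∫ x, (c * Real.exp (v x - 1) - Real.log c) ∂(μ : Measure X) := by
    refine integral_mono (integrable_of_continuous _ hv)
      (integrable_of_continuous _ (by fun_prop)) fun x => ?_
    have := Real.add_one_le_exp (v x - 1 + Real.log c)
    rw [Real.exp_add, Real.exp_log hc] at this
    linarith
  rw [integral_sub ((integrable_of_continuous _ hec).const_mul c) (integrable_const _),
    integral_const_mul] at h2
  simp only [integral_const, probReal_univ, one_smul] at h2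
  exact_mod_cast (by linarith :
    ∫ x, v x ∂μ - ∫ x, Real.exp (v x - 1) ∂(ν : Measure X) ≤ -Real.log c)

theorem reverseKLDivergence_le {μ ν : ProbabilityMeasure X} {c : ℝ} (hc : 0 < c)
    (h : (ν : Measure X) ≤ ENNReal.ofReal c • (μ : Measure X)) :
    reverseKLDivergence X μ ν ≤ ((Real.log c : ℝ) : EReal) := by
  refine hasConj_fRKL.fGAN_le fun v hv hD => ?_
  have hneg : ∀ x, 0 < -v x := fun x => neg_pos.2 (hD x)
  have h1 : ∫ x, -v x ∂(ν : Measure X) ≤ c * ∫ x, -v x ∂μ := by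
    have := integral_mono_measure h (.of_forall fun x => (hneg x).le)
      ((integrable_of_continuous _ hv.neg).smul_measure ENNReal.ofReal_ne_top)
    rwa [integral_smul_measure, ENNReal.toReal_ofReal hc.le, smul_eq_mul] at this
  have h2 : ∫ x, (-(c⁻¹ * -v x) - Real.log c) ∂(ν : Measure X) ≤
      ∫ x, (-1 - Real.log (-v x)) ∂(ν : Measure X) := by
    refine integral_mono (integrable_of_continuous _ (by fun_prop))
      (integrable_of_continuous _ (hasConj_fRKL.continuous_comp hv hD)) fun x => ?_
    have := Real.log_le_sub_one_of_pos (mul_pos (inv_pos.2 hc) (hneg x))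
    rw [Real.log_mul (inv_ne_zero hc.ne') (hneg x).ne', Real.log_inv] at this
    linarith
  rw [integral_sub (integrable_of_continuous _ (by fun_prop)) (integrable_const _),
    integral_neg, integral_const_mul] at h2
  simp only [integral_const, probReal_univ, one_smul] at h2
  have h3 := mul_le_mul_of_nonneg_left h1 (inv_pos.2 hc).le
  rw [inv_mul_cancel_left₀ hc.ne', integral_neg (μ := (μ : Measure X))] at h3
  exact_mod_cast (by linarith :
    ∫ x, v x ∂μ - ∫ x, (-1 - Real.log (-v x)) ∂(ν : Measure X) ≤ Real.log c)

/-- A Urysohn function peaking at `x` with small integral against a measure without mass at `x`. -/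
theorem exists_bump (ρ : ProbabilityMeasure X) {x : X} (hx : (ρ : Measure X) {x} = 0) {η : ℝ}
    (hη : 0 < η) : ∃ φ : C(X, ℝ), (∀ y, φ y ∈ Set.Icc (0 : ℝ) 1) ∧ φ x = 1 ∧ ∫ y, φ y ∂ρ ≤ η := by
  obtain ⟨U, hxU, hU, hUη⟩ := Set.exists_isOpen_lt_of_lt {x} (ENNReal.ofReal η)
    (μ := (ρ : Measure X)) (by rw [hx]; simpa using hη)
  obtain ⟨φ, h0, h1, hφ⟩ := exists_continuous_zero_one_of_isClosed (s := Uᶜ) (t := {x})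
    hU.isClosed_compl isClosed_singleton (by simpa using hxU)
  refine ⟨φ, hφ, h1 rfl, ?_⟩
  calc ∫ y, φ y ∂(ρ : Measure X) ≤ ∫ y, U.indicator 1 y ∂(ρ : Measure X) := by
        refine integral_mono (integrable_of_continuous _ φ.continuous)
          ((integrable_const (1 : ℝ)).indicator hU.measurableSet) fun y => ?_
        by_cases hy : y ∈ U
        · simpa [hy] using (hφ y).2
        · simpa [hy] using (h0 hy).le
    _ = (ρ : Measure X).real U := integral_indicator_one hU.measurableSet
    _ ≤ η := by
        rw [measureReal_def]
        exact ENNReal.toReal_le_of_le_ofReal hη.le hUη.le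

theorem mul_real_singleton_le_integral (ρ : ProbabilityMeasure X) (x : X) {g : X → ℝ}
    (hg : Continuous g) (h0 : ∀ y, 0 ≤ g y) :
    (ρ : Measure X).real {x} * g x ≤ ∫ y, g y ∂ρ := by
  have := setIntegral_le_integral (s := {x}) (integrable_of_continuous (ρ : Measure X) hg)
    (.of_forall h0)
  rwa [integral_singleton, smul_eq_mul] at this

/-- An atom of `μ` that `ν` misses makes the divergence infinite: a test function that is large near
the atom gains linearly in its height against `μ`, while its exponential costs nothing against `ν`
once its support is small. -/
theorem klDivergence_eq_top {μ ν : ProbabilityMeasure X} {x : X}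
    (hμ : 0 < (μ : Measure X).real {x}) (hν : (ν : Measure X) {x} = 0) :
    klDivergence X μ ν = ⊤ := by
  refine EReal.eq_top_iff_forall_lt _ |>.2 fun y => ?_
  set c := (μ : Measure X).real {x}
  set M := (|y| + 3) / c
  have hM : 0 < M := by positivity
  obtain ⟨φ, hφ, hφx, hφν⟩ := exists_bump ν hν (Real.exp_pos (-M))
  refine lt_of_lt_of_le ?_ (hasConj_fKL.le_fGAN (v := fun y => M * φ y) (by fun_prop)
    (fun _ => trivial) μ ν)
  have h1 := mul_real_singleton_le_integral μ x (g := fun y => M * φ y) (by fun_prop)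
    fun y => mul_nonneg hM.le (hφ y).1
  rw [hφx, mul_one] at h1
  have hcM : c * M = |y| + 3 := mul_div_cancel₀ _ hμ.ne'
  have h2 : ∫ y, Real.exp (M * φ y - 1) ∂(ν : Measure X) ≤
      ∫ y, (1 + Real.exp M * φ y) ∂(ν : Measure X) := by
    refine integral_mono (integrable_of_continuous _ (by fun_prop))
      (integrable_of_continuous _ (by fun_prop)) fun y => ?_
    have e1 := convexOn_exp.2 (Set.mem_univ 0) (Set.mem_univ M) (sub_nonneg.2 (hφ y).2) (hφ y).1
      (by ring)
    simp only [smul_eq_mul, mul_zero, zero_add, Real.exp_zero, mul_one] at e1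
    have e2 : Real.exp (M * φ y - 1) ≤ Real.exp (φ y * M) := Real.exp_le_exp.2 (by linarith)
    linarith [(hφ y).1]
  rw [integral_add (integrable_const _) (integrable_of_continuous _ (by fun_prop)),
    integral_const_mul] at h2
  simp only [integral_const, probReal_univ, one_smul] at h2
  have h3 := mul_le_mul_of_nonneg_left hφν (Real.exp_pos M).le
  rw [← Real.exp_add, add_neg_cancel, Real.exp_zero] at h3
  exact_mod_cast (by linarith [le_abs_self y] :
    y < ∫ y, M * φ y ∂(μ : Measure X) - ∫ y, Real.exp (M * φ y - 1) ∂(ν : Measure X))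

/-- An atom of `ν` that `μ` misses makes the divergence infinite: a test function that is very
negative near the atom gains the logarithm of its depth against `ν`, and costs nothing against `μ`
once its support is small. -/
theorem reverseKLDivergence_eq_top {μ ν : ProbabilityMeasure X} {x : X}
    (hμ : (μ : Measure X) {x} = 0) (hν : 0 < (ν : Measure X).real {x}) :
    reverseKLDivergence X μ ν = ⊤ := by
  refine EReal.eq_top_iff_forall_lt _ |>.2 fun y => ?_
  set c := (ν : Measure X).real {x}
  set M := Real.exp ((|y| + 2) / c) with hMdef
  have hM : 0 < M := Real.exp_pos _
  obtain ⟨φ, hφ, hφx, hφμ⟩ := exists_bump μ hμ (inv_pos.2 hM)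
  have hpos : ∀ y, 0 < 1 + M * φ y := fun y => by
    have := mul_nonneg hM.le (hφ y).1
    linarith
  have hD : ∀ y, -1 - M * φ y ∈ Set.Iio (0 : ℝ) := fun y => by
    have := hpos y
    simp only [Set.mem_Iio]
    linarith
  refine lt_of_lt_of_le ?_ (hasConj_fRKL.le_fGAN (v := fun y => -1 - M * φ y) (by fun_prop)
    hD μ ν)
  have e : ∀ y, -(-1 - M * φ y) = 1 + M * φ y := fun y => by ring
  simp only [e]
  have hlc : Continuous fun y => Real.log (1 + M * φ y) :=
    Continuous.log (by fun_prop) fun y => (hpos y).ne'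
  have h1 := mul_real_singleton_le_integral ν x hlc fun y =>
    Real.log_nonneg (by linarith [mul_nonneg hM.le (hφ y).1])
  rw [hφx, mul_one] at h1
  have h2 : (|y| + 2) / c ≤ Real.log (1 + M) := by
    rw [Real.le_log_iff_exp_le (by linarith)]
    linarith
  rw [div_le_iff₀ hν] at h2
  rw [integral_sub (integrable_const _) (integrable_of_continuous _ (by fun_prop)),
    integral_sub (integrable_const _) (integrable_of_continuous _ hlc), integral_const_mul]
  simp only [integral_const, probReal_univ, one_smul]
  have h3 := mul_le_mul_of_nonneg_left hφμ hM.le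
  rw [mul_inv_cancel₀ hM.ne'] at h3
  exact_mod_cast (by linarith [le_abs_self y] :
    y < -1 - M * ∫ y, φ y ∂(μ : Measure X) - (-1 - ∫ y, Real.log (1 + M * φ y) ∂(ν : Measure X)))

/-- A vanishing fraction of the mass is moved from `a` to `b`. -/
theorem not_klDivergence_stronger_reverseKLDivergence [Nontrivial X] :
    ¬ Stronger (klDivergence X) (reverseKLDivergence X) := by
  intro h
  obtain ⟨a, b, hab⟩ := exists_pair_ne X
  have hε : ∀ n : ℕ, 0 < 1 / ((n : ℝ) + 1 + 1) ∧ 1 / ((n : ℝ) + 1 + 1) < 1 := fun n =>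
    ⟨by positivity, by rw [div_lt_one (by positivity)]; linarith [n.cast_nonneg (α := ℝ)]⟩
  let ε : ℕ → ℝ := fun n => 1 / ((n : ℝ) + 1 + 1)
  let μ : ProbabilityMeasure X := ⟨Measure.dirac a, inferInstance⟩
  let ν : ℕ → ProbabilityMeasure X := fun n =>
    ⟨ENNReal.ofReal (1 - ε n) • Measure.dirac a + ENNReal.ofReal (ε n) • Measure.dirac b, ⟨by
      simp only [Measure.coe_add, Measure.coe_smul, Pi.add_apply, Pi.smul_apply, measure_univ,
        smul_eq_mul, mul_one]
      rw [← ENNReal.ofReal_add (sub_nonneg.2 (hε n).2.le) (hε n).1.le, sub_add_cancel,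
        ENNReal.ofReal_one]⟩⟩
  have hεlim : Tendsto ε atTop (𝓝 0) :=
    (tendsto_add_atTop_iff_nat (f := fun n : ℕ => 1 / ((n : ℝ) + 1)) 1).2
      tendsto_one_div_add_atTop_nhds_zero_nat |>.congr fun n => by simp [ε]
  have hKL : Tendsto (fun n => klDivergence X μ (ν n)) atTop (𝓝 0) := by
    refine tendsto_of_tendsto_of_tendsto_of_le_of_le (g := fun _ => (0 : EReal))
      (h := fun n => ((-Real.log (1 - ε n) : ℝ) : EReal)) tendsto_const_nhds ?_
      (fun n => hasConj_fKL.fGAN_nonneg _ _) fun n => klDivergence_le (sub_pos.2 (hε n).2) ?_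
    · have h1 : Tendsto (fun n => -Real.log (1 - ε n)) atTop (𝓝 0) := by
        simpa using (((tendsto_const_nhds (x := (1 : ℝ))).sub hεlim).log (by simp)).neg
      exact (continuous_coe_real_ereal.tendsto 0).comp h1
    · exact Measure.le_add_right le_rfl
  have h2 := h ν μ (by rwa [klDivergence, hasConj_fKL.minVal_eq])
  rw [reverseKLDivergence, hasConj_fRKL.minVal_eq] at h2
  have htop : ∀ n, fGAN X fRKL μ (ν n) = ⊤ := fun n => by
    refine reverseKLDivergence_eq_top (x := b) ?_ ?_
    · simp [μ, hab]
    · have : (ν n : Measure X) {b} = ENNReal.ofReal (ε n) := by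
        simp [ν, hab]
      rw [measureReal_def, this, ENNReal.toReal_ofReal (hε n).1.le]
      exact (hε n).1
  simp only [htop] at h2
  exact absurd (tendsto_nhds_unique h2 tendsto_const_nhds) EReal.zero_ne_top

theorem exists_measure_with_infinitely_many_atoms [Infinite X] :
    ∃ (x : ℕ → X) (μ : ProbabilityMeasure X), Function.Injective x ∧
      (∀ n, 0 < (μ : Measure X).real {x n}) ∧
      Tendsto (fun n => (μ : Measure X).real {x n}) atTop (𝓝 0) := by
  let x : ℕ → X := Infinite.natEmbedding X
  have hx : Function.Injective x := (Infinite.natEmbedding X).injective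
  let P := ProbabilityTheory.poissonMeasure 1
  have hm : Measurable x := measurable_of_countable x
  have hval : ∀ n, (P.map x).real {x n} = P.real {n} := fun n => by
    rw [map_measureReal_apply hm (measurableSet_singleton _)]
    congr 1
    ext m
    simp [hx.eq_iff]
  refine ⟨x, ⟨P.map x, Measure.isProbabilityMeasure_map hm.aemeasurable⟩, hx, fun n => ?_, ?_⟩
  · exact (ProbabilityTheory.poissonMeasure_real_singleton_pos n one_pos).trans_eq (hval n).symm
  · refine (ProbabilityTheory.hasSum_one_poissonMeasure 1).summable.tendsto_atTop_zero.congr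
      fun n => ?_
    rw [← ProbabilityTheory.poissonMeasure_real_singleton]
    exact (hval n).symm

/-- Conditioning on the complement of an atom of small mass is a small change for the reverse
Kullback–Leibler divergence, but makes the Kullback–Leibler divergence infinite. -/
theorem not_reverseKLDivergence_stronger_klDivergence [Infinite X] :
    ¬ Stronger (reverseKLDivergence X) (klDivergence X) := by
  intro h
  obtain ⟨x, μ, hx, hpos, hlim⟩ := exists_measure_with_infinitely_many_atoms (X := X)
  have hs : ∀ n, 0 < (μ : Measure X).real {x n}ᶜ := fun n =>
    (hpos (n + 1)).trans_le (measureReal_mono (by simp [hx.eq_iff]))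
  have hs0 : ∀ n, (μ : Measure X) {x n}ᶜ ≠ 0 := fun n h0 => by
    have := hs n
    rw [measureReal_def, h0] at this
    exact lt_irrefl _ this
  let ν : ℕ → ProbabilityMeasure X := fun n =>
    ⟨ProbabilityTheory.cond (μ : Measure X) {x n}ᶜ,
      ProbabilityTheory.cond_isProbabilityMeasure (hs0 n)⟩
  have hRKL : Tendsto (fun n => reverseKLDivergence X μ (ν n)) atTop (𝓝 0) := by
    refine tendsto_of_tendsto_of_tendsto_of_le_of_le (g := fun _ => (0 : EReal))
      (h := fun n => ((Real.log ((μ : Measure X).real {x n}ᶜ)⁻¹ : ℝ) : EReal))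
      tendsto_const_nhds ?_ (fun n => hasConj_fRKL.fGAN_nonneg _ _)
      fun n => reverseKLDivergence_le (inv_pos.2 (hs n)) ?_
    · have h1 : Tendsto (fun n => (μ : Measure X).real {x n}ᶜ) atTop (𝓝 1) := by
        simp_rw [probReal_compl_eq_one_sub (measurableSet_singleton _)]
        simpa using (tendsto_const_nhds (x := (1 : ℝ))).sub hlim
      have h2 : Tendsto (fun n => Real.log ((μ : Measure X).real {x n}ᶜ)⁻¹) atTop (𝓝 0) := by
        simpa using (h1.inv₀ one_ne_zero).log (by simp)
      exact (continuous_coe_real_ereal.tendsto 0).comp h2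
    · have e : ENNReal.ofReal ((μ : Measure X).real {x n}ᶜ)⁻¹ = ((μ : Measure X) {x n}ᶜ)⁻¹ := by
        rw [ENNReal.ofReal_inv_of_pos (hs n), ofReal_measureReal]
      rw [e]
      refine Measure.le_iff'.2 fun t => ?_
      change (_ : ENNReal) * (μ : Measure X).restrict {x n}ᶜ t ≤ _ * (μ : Measure X) t
      gcongr
      exact Measure.restrict_le_self
  have h2 := h ν μ (by rwa [reverseKLDivergence, hasConj_fRKL.minVal_eq])
  rw [klDivergence, hasConj_fKL.minVal_eq] at h2
  have htop : ∀ n, fGAN X fKL μ (ν n) = ⊤ := fun n => by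
    refine klDivergence_eq_top (x := x n) (hpos n) ?_
    change ProbabilityTheory.cond (μ : Measure X) {x n}ᶜ {x n} = 0
    rw [ProbabilityTheory.cond_apply (measurableSet_singleton _).compl]
    simp
  simp only [htop] at h2
  exact absurd (tendsto_nhds_unique h2 tendsto_const_nhds) EReal.zero_ne_top

/-- Point masses at points converging to `a` converge weakly to the point mass at `a`, but stay at
total variation distance `1` from it. -/
theorem not_wassersteinDivergence_stronger_tvDivergence [Infinite X] {K : ℝ≥0} (hK : 0 < K) :
    ¬ Stronger (wassersteinDivergence X K) (tvDivergence X) := by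
  intro h
  obtain ⟨a, ha⟩ := Set.infinite_univ (α := X).exists_accPt_principal
  have : (𝓝[≠] a).NeBot := by simpa [AccPt] using ha
  obtain ⟨x, hx⟩ := exists_seq_tendsto (𝓝[≠] a)
  obtain ⟨hxa, hne⟩ := tendsto_nhdsWithin_iff.1 hx
  let δ : X → ProbabilityMeasure X := fun y => ⟨Measure.dirac y, inferInstance⟩
  have hδ : Tendsto (fun n => δ (x n)) atTop (𝓝 (δ a)) := by
    refine ProbabilityMeasure.tendsto_iff_forall_integral_tendsto.2 fun g => ?_
    simp only [δ, ProbabilityMeasure.coe_mk, integral_dirac]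
    exact (g.continuous.tendsto a).comp hxa
  have h1 := tendsto_wassersteinDivergence K hδ
  rw [← minVal_eq_zero (wassersteinDivergence_self K) (wassersteinDivergence_pos hK) (δ a)] at h1
  have h2 := h _ _ h1
  rw [tvDivergence, hasConj_fTV.minVal_eq] at h2
  obtain ⟨n, hn, hnne⟩ := ((eventually_lt_of_tendsto_zero h2 one_pos).and hne).exists
  refine hn.not_ge ?_
  have hd : 0 < dist (x n) a := dist_pos.2 hnne
  refine le_trans (le_of_eq ?_) (hasConj_fTV.le_fGAN
    (v := fun y => max (-(1 / 2)) (1 / 2 - dist y a / dist (x n) a)) (by fun_prop)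
    (fun y => ⟨le_max_left _ _, max_le (by norm_num) ?_⟩) (δ a) (δ (x n)))
  · simp only [δ, ProbabilityMeasure.coe_mk, integral_dirac, id, dist_self, zero_div,
      div_self hd.ne']
    norm_num
  · have : 0 ≤ dist y a / dist (x n) a := by positivity
    linarith

end Infinite

end AdvDiv

end

/-! ### The hierarchy -/

theorem corollary2 {d : ℕ} (X : Set (EuclideanSpace ℝ (Fin d)))
    (hX : IsClosed X) (hb : Bornology.IsBounded X)
    (k : X → X → ℝ) (hk : AdvDiv.IsUniversalKernel k)
    (K : NNReal) (hK : 0 < K) :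
    -- all eight are strict adversarial divergences
    (AdvDiv.IsStrict (AdvDiv.trivialDiv X) ∧
      AdvDiv.IsStrict (AdvDiv.klDivergence X) ∧
      AdvDiv.IsStrict (AdvDiv.reverseKLDivergence X) ∧
      AdvDiv.IsStrict (AdvDiv.tvDivergence X) ∧
      AdvDiv.IsStrict (AdvDiv.jsDivergence X) ∧
      AdvDiv.IsStrict (AdvDiv.hellingerDivergence X) ∧
      AdvDiv.IsStrict (AdvDiv.mmdDivergence k) ∧
      AdvDiv.IsStrict (AdvDiv.wassersteinDivergence X K)) ∧
    -- the strongest and the weakest strict adversarial divergences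
    (∀ τ : AdvDiv.Divergence X, AdvDiv.IsStrict τ →
      AdvDiv.Stronger (AdvDiv.trivialDiv X) τ ∧
      AdvDiv.Stronger τ (AdvDiv.wassersteinDivergence X K) ∧
      AdvDiv.Stronger τ (AdvDiv.mmdDivergence k)) ∧
    -- the equivalences
    (AdvDiv.Equivalent (AdvDiv.tvDivergence X) (AdvDiv.jsDivergence X) ∧
      AdvDiv.Equivalent (AdvDiv.tvDivergence X) (AdvDiv.hellingerDivergence X) ∧
      AdvDiv.Equivalent (AdvDiv.wassersteinDivergence X K) (AdvDiv.mmdDivergence k)) ∧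
    -- the non-strict relations in the middle of the hierarchy
    (AdvDiv.Stronger (AdvDiv.klDivergence X) (AdvDiv.tvDivergence X) ∧
      AdvDiv.Stronger (AdvDiv.reverseKLDivergence X) (AdvDiv.tvDivergence X)) ∧
    -- on an infinite space the hierarchy is strict
    (X.Infinite →
      AdvDiv.StrictlyStronger (AdvDiv.trivialDiv X) (AdvDiv.klDivergence X) ∧
      AdvDiv.StrictlyStronger (AdvDiv.trivialDiv X) (AdvDiv.reverseKLDivergence X) ∧
      AdvDiv.StrictlyStronger (AdvDiv.klDivergence X) (AdvDiv.tvDivergence X) ∧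
      AdvDiv.StrictlyStronger (AdvDiv.reverseKLDivergence X) (AdvDiv.tvDivergence X) ∧
      AdvDiv.NotComparable (AdvDiv.klDivergence X) (AdvDiv.reverseKLDivergence X) ∧
      AdvDiv.StrictlyStronger (AdvDiv.tvDivergence X)
        (AdvDiv.wassersteinDivergence X K)) := by
  have : CompactSpace X :=
    isCompact_iff_compactSpace.1 (Metric.isCompact_of_isClosed_isBounded hX hb)
  have hW : AdvDiv.IsStrict (AdvDiv.wassersteinDivergence X K) :=
    AdvDiv.isStrict_wassersteinDivergence hK
  have hM : AdvDiv.IsStrict (AdvDiv.mmdDivergence k) := AdvDiv.isStrict_mmdDivergence hk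
  have hKL : AdvDiv.IsStrict (AdvDiv.klDivergence X) := AdvDiv.hasConj_fKL.isStrict
  have hRKL : AdvDiv.IsStrict (AdvDiv.reverseKLDivergence X) := AdvDiv.hasConj_fRKL.isStrict
  have hTV : AdvDiv.IsStrict (AdvDiv.tvDivergence X) := AdvDiv.hasConj_fTV.isStrict
  have hKLTV : AdvDiv.Stronger (AdvDiv.klDivergence X) (AdvDiv.tvDivergence X) :=
    AdvDiv.hasConj_fKL.stronger_tvDivergence
  have hRKLTV : AdvDiv.Stronger (AdvDiv.reverseKLDivergence X) (AdvDiv.tvDivergence X) :=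
    AdvDiv.hasConj_fRKL.stronger_tvDivergence
  refine ⟨⟨AdvDiv.isStrict_trivialDiv, hKL, hRKL, hTV, AdvDiv.hasConj_fJS.isStrict,
    AdvDiv.hasConj_fHellinger.isStrict, hM, hW⟩,
    fun τ hτ => ⟨AdvDiv.stronger_trivialDiv hτ, hτ.stronger_wassersteinDivergence hK,
      hτ.stronger_mmdDivergence hk⟩,
    ⟨⟨AdvDiv.tvDivergence_stronger_jsDivergence, AdvDiv.hasConj_fJS.stronger_tvDivergence⟩,
      ⟨AdvDiv.tvDivergence_stronger_hellingerDivergence,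
        AdvDiv.hasConj_fHellinger.stronger_tvDivergence⟩,
      ⟨hW.stronger_mmdDivergence hk, hM.stronger_wassersteinDivergence hK⟩⟩,
    ⟨hKLTV, hRKLTV⟩, fun hinf => ?_⟩
  have : Infinite X := hinf.to_subtype
  have h1 : ¬ AdvDiv.Stronger (AdvDiv.klDivergence X) (AdvDiv.reverseKLDivergence X) :=
    AdvDiv.not_klDivergence_stronger_reverseKLDivergence
  have h2 : ¬ AdvDiv.Stronger (AdvDiv.reverseKLDivergence X) (AdvDiv.klDivergence X) :=
    AdvDiv.not_reverseKLDivergence_stronger_klDivergence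
  -- by transitivity, an equivalence next to `KL` or reverse `KL` would make the two comparable
  exact ⟨⟨AdvDiv.stronger_trivialDiv hKL,
      fun h => h1 (h.2.trans (AdvDiv.stronger_trivialDiv hRKL))⟩,
    ⟨AdvDiv.stronger_trivialDiv hRKL, fun h => h2 (h.2.trans (AdvDiv.stronger_trivialDiv hKL))⟩,
    ⟨hKLTV, fun h => h2 (hRKLTV.trans h.2)⟩,
    ⟨hRKLTV, fun h => h1 (hKLTV.trans h.2)⟩,
    ⟨h1, h2⟩,
    ⟨hTV.stronger_wassersteinDivergence hK,
      fun h => AdvDiv.not_wassersteinDivergence_stronger_tvDivergence hK h.2⟩⟩
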